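/- All graphs are finite, undirected and simple. An exact $(k,d)$-coloring of a graph $G$ is a map $c : V(G) \to \{1,\dots,k\}$ such that every vertex $v$ has exactly $d$ neighbours $w$ with $c(w)=c(v)$; the exact $d$-defective chromatic number $\chi_d^{=}(G)$ is the least $k$ for which $G$ has an exact $(k,d)$-coloring (and $\infty$ if there is none). The problem $d$-Exact Defective $k$-Coloring asks, for a given graph $G$, whether $\chi_d^{=}(G)\le k$. A block of a graph is a maximal connected subgraph without a cutvertex, and a block graph is a graph, connected or not, all of whose blocks are complete. **Theorem.** Let $k$ and $d$ be positive integers. 1. The problem $d$-Exact Defective $k$-Coloring is solvable in linear time on block graphs. That is, there are a program for a random access machine and a constant $C$ (both may depend on $k$ and $d$) such that for every block graph $G$ with $n$ vertices and $m$ edges, given by the adjacency lists of its vertices in any order, the program halts after at most $C\,(n+m+1)$ steps and answers correctly whether $\chi_d^{=}(G)\le k$. Here every step (an assignment of a constant or of a register, an addition or subtraction, an indirect read or write in an array, a comparison of two registers, or a control step) has unit cost, and all numbers written to registers and array cells, and all addresses written to, are at most $C\,(n+m+1)$, i.e. machine words have $\log(n+m+1)+O(1)$ bits. 2. In every exact $(k,d)$-coloring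 of a block graph, each color class induces a disjoint union of cliques with $d+1$ vertices: every connected component of the subgraph induced by a color class is a complete graph on exactly $d+1$ vertices. -/

import Mathlib

/-! ### Graph notions -/

namespace SimpleGraph

universe u

variable {V : Type u}

/-- `c` is an exact `(k, d)`-coloring of `G`: every vertex `v` has exactly `d` neighbours
having the same color as `v`. -/
def IsExactColoring (G : SimpleGraph V) {k : ℕ} (d : ℕ) (c : V → Fin k) : Prop :=
  ∀ v : V, {w : V | G.Adj v w ∧ c w = c v}.encard = (d : ℕ∞)

/-- The exact `d`-defective chromatic number: the least `k` such that `G` has an exact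
`(k, d)`-coloring, and `⊤` if there is no such `k`. -/
noncomputable def exactChromaticNumber (G : SimpleGraph V) (d : ℕ) : ℕ∞ :=
  sInf {m : ℕ∞ | ∃ k : ℕ, m = (k : ℕ∞) ∧ ∃ c : V → Fin k, G.IsExactColoring d c}

/-- The subgraph induced by `S` is connected (in particular non-empty) and has no cutvertex. -/
def IsNonseparable (G : SimpleGraph V) (S : Set V) : Prop :=
  (G.induce S).Connected ∧ ∀ v ∈ S, (G.induce (S \ {v})).Preconnected

/-- `S` is the vertex set of a block of `G`, a maximal connected subgraph without a cutvertex
(such subgraphs are induced, so that their vertex sets determine them). -/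
def IsBlock (G : SimpleGraph V) (S : Set V) : Prop :=
  Maximal G.IsNonseparable S

/-- A block graph: every block is complete. -/
def IsBlockGraph (G : SimpleGraph V) : Prop :=
  ∀ S : Set V, G.IsBlock S → G.IsClique S

/-- `nbr` lists, for every vertex, its neighbours without repetition, in an arbitrary order. -/
def IsAdjacencyList {n : ℕ} (G : SimpleGraph (Fin n)) (nbr : Fin n → List (Fin n)) : Prop :=
  ∀ v : Fin n, (nbr v).Nodup ∧ ∀ w : Fin n, w ∈ nbr v ↔ G.Adj v w

end SimpleGraph

/-! ### A random access machine with unit-cost instructions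

Programs are written in structured form. A program is a finite piece of text, so it mentions
finitely many registers and finitely many arrays. Machine words are the numbers `0, …, W`. -/

namespace RAM

/-- The contents of the registers and of the arrays. -/
structure Store where
  reg : ℕ → ℕ
  arr : ℕ → ℕ → ℕ

inductive Test where
  /-- register `x` is less than register `y` -/
  | lt (x y : ℕ)
  /-- register `x` equals register `y` -/
  | eq (x y : ℕ)

inductive Prog where
  | skip
  /-- `x := m` for a constant `m` of the program -/
  | const (x m : ℕ)
  /-- `x := y` -/
  | copy (x y : ℕ)
  /-- `x := y + z` -/
  | add (x y z : ℕ)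
  /-- `x := max (y - z) 0` -/
  | sub (x y z : ℕ)
  /-- `x := a[y]` -/
  | load (x a y : ℕ)
  /-- `a[x] := y` -/
  | store (a x y : ℕ)
  | seq (p q : Prog)
  | ite (b : Test) (p q : Prog)
  | while (b : Test) (p : Prog)

def Test.eval : Test → Store → Bool
  | .lt x y, σ => decide (σ.reg x < σ.reg y)
  | .eq x y, σ => decide (σ.reg x = σ.reg y)

/-- Write `v` to register `x`. -/
def Store.setReg (σ : Store) (x v : ℕ) : Store :=
  { σ with reg := Function.update σ.reg x v }

/-- Write `v` to the cell of address `i` of the array `a`. -/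
def Store.setArr (σ : Store) (a i v : ℕ) : Store :=
  { σ with arr := Function.update σ.arr a (Function.update (σ.arr a) i v) }

/-- A configuration: the stack of program parts still to be executed, and the store. -/
structure Config where
  todo : List Prog
  store : Store

/-- Continue with `K` after writing `v` to register `x`; overflow (`W < v`) is fatal. -/
def writeReg (W : ℕ) (K : List Prog) (σ : Store) (x v : ℕ) : Option Config :=
  if v ≤ W then some ⟨K, σ.setReg x v⟩ else none

/-- Continue with `K` after writing `v` to the cell `a[i]`; overflow (`W < v`) and addresses
that are not machine words (`W < i`) are fatal. -/
def writeArr (W : ℕ) (K : List Prog) (σ : Store) (a i v : ℕ) : Option Config :=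
  if i ≤ W ∧ v ≤ W then some ⟨K, σ.setArr a i v⟩ else none

/-- One step of the machine with machine words `0, …, W`. There is no next configuration
(`none`) after a fatal error, and also when the program has ended. -/
def step (W : ℕ) : Config → Option Config
  | ⟨[], _⟩ => none
  | ⟨.skip :: K, σ⟩ => some ⟨K, σ⟩
  | ⟨.const x m :: K, σ⟩ => writeReg W K σ x m
  | ⟨.copy x y :: K, σ⟩ => writeReg W K σ x (σ.reg y)
  | ⟨.add x y z :: K, σ⟩ => writeReg W K σ x (σ.reg y + σ.reg z)
  | ⟨.sub x y z :: K, σ⟩ => writeReg W K σ x (σ.reg y - σ.reg z)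
  | ⟨.load x a y :: K, σ⟩ => writeReg W K σ x (σ.arr a (σ.reg y))
  | ⟨.store a x y :: K, σ⟩ => writeArr W K σ a (σ.reg x) (σ.reg y)
  | ⟨.seq p q :: K, σ⟩ => some ⟨p :: q :: K, σ⟩
  | ⟨.ite b p q :: K, σ⟩ => some ⟨(if b.eval σ then p else q) :: K, σ⟩
  | ⟨.while b p :: K, σ⟩ => some ⟨if b.eval σ then p :: .while b p :: K else K, σ⟩

/-- The configuration after exactly `t` steps, if there is one. -/
def run (W : ℕ) : ℕ → Config → Option Config
  | 0, c => some c
  | t + 1, c => (step W c).bind (run W t)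

/-- Started on the store `σ`, the program `p` ends after exactly `t` steps, without a fatal
error, with the store `τ`. -/
def Computes (W : ℕ) (p : Prog) (σ : Store) (t : ℕ) (τ : Store) : Prop :=
  run W t ⟨[p], σ⟩ = some ⟨[], τ⟩

/-- The input given by the adjacency lists `nbr`: register `0` holds the number `n` of vertices,
array `1` holds the concatenation of the lists of the vertices `0, …, n - 1`, and for `v ≤ n`
the cell `v` of array `0` holds the total length of the lists of the vertices below `v`, so that
the list of `v < n` occupies the cells `i` of array `1` with `arr 0 v ≤ i < arr 0 (v + 1)`.
Everything else is `0`. -/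
def inputStore {n : ℕ} (nbr : Fin n → List (Fin n)) : Store where
  reg x := if x = 0 then n else 0
  arr a i :=
    if a = 0 then (if i ≤ n then (((List.ofFn nbr).take i).map List.length).sum else 0)
    else if a = 1 then ((List.ofFn nbr).flatten.map Fin.val).getD i 0
    else 0

/-- The decision problem `Q` on graphs is solvable in linear time on the graphs in the class `𝒢`:
there are a program and a constant `C` such that on every graph with `n` vertices and `m` edges
in the class, given by adjacency lists, the program ends after at most `C * (n + m + 1)` steps
and answers correctly (`1` for yes, `0` for no) in register `0`, all machine words being at most
`C * (n + m + 1)`, that is, having `log (n + m + 1) + O(1)` bits. -/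
def SolvableInLinearTimeOn (𝒢 Q : ∀ n : ℕ, SimpleGraph (Fin n) → Prop) : Prop :=
  ∃ (p : Prog) (C : ℕ), ∀ (n : ℕ) (G : SimpleGraph (Fin n)) (nbr : Fin n → List (Fin n)),
    𝒢 n G → G.IsAdjacencyList nbr →
      ∃ (t : ℕ) (τ : Store), t ≤ C * (n + G.edgeSet.ncard + 1) ∧
        Computes (C * (n + G.edgeSet.ncard + 1)) p (inputStore nbr) t τ ∧
        (Q n G → τ.reg 0 = 1) ∧ (¬ Q n G → τ.reg 0 = 0)

end RAM

/-!
# Exact defective colorings of block graphs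

Two neighbours `a`, `b` of a vertex `v` of a block graph that are joined by a path avoiding `v` lie
with `v` on a cycle, hence in a common block, and are adjacent (`IsBlockGraph.adj_of_walk`). If some
color class of an exact coloring had vertices `x ~ y ~ z` with `x`, `z` not adjacent, then `x` would
need a neighbour of its color that is not adjacent to `y`, as it has as many such neighbours as `y`;
it lies in a smaller part of the color class than `x` does when `y` is removed, so this cannot go on
forever. Hence every color class is a disjoint union of cliques with `d + 1` vertices
(`IsBlockGraph.isClique_supp_of_isExactColoring`).

For the algorithm, search the graph breadth-first. Every edge then joins a vertex to its parent in
the search tree or joins two children of the same parent (`IsSearchOrder.par_eq_or`), so that a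
block consists of a parent and a class of pairwise adjacent children, its siblings. Visit the blocks
from the last to the first. All vertices of a block except the parent either are *covered* by a
monochromatic clique of a lower block or must be divided into cliques of `d + 1` vertices inside the
block, possibly together with the parent. So the number of free vertices is `0` or `d` modulo
`d + 1`, and it determines whether the block covers its parent. An exact coloring exists exactly if
these remainders occur in all blocks, every root is covered by one block and every other vertex by
at most one, and every block meets at most `k` cliques
(`IsSearchOrder.exactChromaticNumber_le_iff_isFeasible`). Necessity is a count of the colors in each
block; for sufficiency the blocks are colored from the roots downwards, by cyclic shifts of a
numbering of the cliques of each block.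

The machine program `exactColoringProg` computes the search order with a queue and then evaluates
the criterion in the reverse order, both with a constant number of scans of each adjacency list. Its
correctness and running time are derived with a weakest-precondition calculus that counts steps
(`wp`, `exists_computes_of_wp`, `wp_while`).
-/

/-! ### Cycles and cliques in block graphs -/

namespace SimpleGraph

open Finset

universe u

variable {V : Type u} {G : SimpleGraph V}

theorem IsBlockGraph.isClique_of_isNonseparable [Finite V] (hG : G.IsBlockGraph) {S : Set V}
    (hS : G.IsNonseparable S) : G.IsClique S := by
  obtain ⟨T, hST, hT⟩ := Finite.exists_le_maximal (p := G.IsNonseparable) hS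
  exact (hG T hT).subset hST

/-- A path together with a further vertex adjacent to both of its ends is a cycle, hence lies in a
block. -/
theorem IsBlockGraph.isClique_insert_support [Finite V] (hG : G.IsBlockGraph) {a b v : V}
    {p : G.Walk a b} (hp : p.IsPath) (hv : v ∉ p.support) (ha : G.Adj v a) (hb : G.Adj v b) :
    G.IsClique {x | x = v ∨ x ∈ p.support} := by
  apply hG.isClique_of_isNonseparable
  constructor
  · have h : {x | x = v ∨ x ∈ p.support} = {x | x ∈ (Walk.cons ha p).support} := by
      ext x
      simp
    rw [h]
    exact (Walk.cons ha p).connected_induce_support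
  intro u hu
  by_cases huv : u = v
  · subst huv
    have h := p.connected_induce_support.preconnected
    have : ({x | x = u ∨ x ∈ p.support} \ {u} : Set V) = {x | x ∈ p.support} := by
      ext x
      simp only [Set.mem_sdiff, Set.mem_ofPred_eq, Set.mem_singleton_iff]
      constructor
      · tauto
      · intro hx
        exact ⟨Or.inr hx, fun h => hv (h ▸ hx)⟩
    rwa [this]
  set T : Set V := {x | x = v ∨ x ∈ p.support} \ {u} with hT
  have hvT : v ∈ T := ⟨Or.inl rfl, fun h => huv h.symm⟩
  -- A vertex of the cycle other than `u` is joined to `v` along the arc that avoids `u`.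
  have key : ∀ x (hx : x ∈ T), (G.induce T).Reachable ⟨v, hvT⟩ ⟨x, hx⟩ := by
    intro x hx
    obtain ⟨hx1, hxu⟩ := hx
    simp only [Set.mem_singleton_iff] at hxu
    rcases hx1 with rfl | hxp
    · exact Reachable.refl _
    obtain ⟨q, r, hq, hr, hqr⟩ := hp.mem_support_iff_exists_append.1 hxp
    have hsub : ∀ y, y ∈ q.support ∨ y ∈ r.support → y ∈ p.support := by
      intro y hy
      rw [hqr, Walk.mem_support_append_iff]
      exact hy
    by_cases huq : u ∈ q.support
    · have hur : u ∉ r.support := fun h =>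
        (hqr ▸ hp).ne_of_mem_support_of_append (fun e => hxu e.symm) huq h rfl
      have hall : ∀ y ∈ (Walk.cons hb r.reverse).support, y ∈ T := by
        intro y hy
        rw [Walk.support_cons, List.mem_cons, Walk.support_reverse, List.mem_reverse] at hy
        rcases hy with rfl | hy
        · exact hvT
        · exact ⟨Or.inr (hsub y (Or.inr hy)), fun h => hur (h ▸ hy)⟩
      exact ((Walk.cons hb r.reverse).induce T hall).reachable
    · have hall : ∀ y ∈ (Walk.cons ha q).support, y ∈ T := by
        intro y hy
        rw [Walk.support_cons, List.mem_cons] at hy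
        rcases hy with rfl | hy
        · exact hvT
        · exact ⟨Or.inr (hsub y (Or.inl hy)), fun h => huq (h ▸ hy)⟩
      exact ((Walk.cons ha q).induce T hall).reachable
  exact fun x y => (key x.1 x.2).symm.trans (key y.1 y.2)

theorem IsBlockGraph.adj_of_walk [Finite V] (hG : G.IsBlockGraph) {a b v : V} (p : G.Walk a b)
    (hv : v ∉ p.support) (ha : G.Adj v a) (hb : G.Adj v b) (hab : a ≠ b) : G.Adj a b := by
  classical
  have h := hG.isClique_insert_support p.toPath.2
    (fun h => hv (Walk.support_toPath_subset_support p h)) ha hb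
  exact h (Or.inr (Walk.start_mem_support _)) (Or.inr (Walk.end_mem_support _)) hab

/-- Block graphs contain no induced diamond. -/
theorem IsBlockGraph.adj_of_diamond [Finite V] (hG : G.IsBlockGraph) {a b x y : V}
    (hab : G.Adj a b) (hax : G.Adj a x) (hay : G.Adj a y) (hbx : G.Adj b x) (hby : G.Adj b y)
    (hxy : x ≠ y) : G.Adj x y := by
  let p : G.Walk a b := Walk.cons hay (Walk.cons hby.symm Walk.nil)
  have hp : p.IsPath := by
    simp [p, Walk.cons_isPath_iff, hay.ne, hab.ne, hby.ne']
  have hx : x ∉ p.support := by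
    simp [p, hax.ne', hbx.ne', hxy]
  have h := hG.isClique_insert_support hp hx hax.symm hbx.symm
  exact h (Or.inl rfl) (Or.inr (by simp [p])) hxy

/-! ### Color classes of exact colorings -/

open scoped Classical in
theorem isExactColoring_iff_card_eq [Fintype V] {k d : ℕ} {c : V → Fin k} :
    G.IsExactColoring d c ↔ ∀ v, #{w | G.Adj v w ∧ c w = c v} = d := by
  refine forall_congr' fun v => ?_
  rw [← Set.coe_toFinset {w | G.Adj v w ∧ c w = c v}, Set.encard_coe_eq_coe_finsetCard,
    Nat.cast_inj]
  simp only [Set.toFinset_ofPred]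

/-- In an exact coloring of a block graph, adjacency of vertices of equal color is transitive. -/
theorem IsBlockGraph.adj_trans_of_isExactColoring [Finite V] (hG : G.IsBlockGraph) {k d : ℕ}
    {c : V → Fin k} (hc : G.IsExactColoring d c) {x y z : V} (hxy : G.Adj x y) (hyz : G.Adj y z)
    (hxz : x ≠ z) (cxy : c x = c y) (cyz : c z = c y) : G.Adj x z := by
  classical
  have := Fintype.ofFinite V
  -- `R y` is adjacency in the color class of `y` with `y` removed, `B y x` is the part reached
  -- from `x`. A counterexample with the least such part leads to one with a smaller part.
  let R : V → V → V → Prop := fun y a b => G.Adj a b ∧ c b = c y ∧ b ≠ y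
  let B : V → V → Finset V := fun y x => {u | Relation.ReflTransGen (R y) x u}
  have walk : ∀ y x u, x ≠ y → Relation.ReflTransGen (R y) x u →
      ∃ p : G.Walk x u, y ∉ p.support := by
    intro y x u hx h
    induction h with
    | refl => exact ⟨Walk.nil, by simpa using hx.symm⟩
    | tail _ h ih =>
      obtain ⟨p, hp⟩ := ih
      refine ⟨p.concat h.1, ?_⟩
      rw [Walk.support_concat]
      simp [hp, h.2.2.symm]
  have card := isExactColoring_iff_card_eq.1 hc
  by_contra hnxz
  have main : ∀ N x y z, (B y x).card = N → G.Adj x y → G.Adj y z → x ≠ z → c x = c y →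
      c z = c y → ¬ G.Adj x z → False := by
    intro N
    induction N using Nat.strong_induction_on with
    | _ N ih =>
    intro x y z hN hxy hyz hxz cxy cyz hnxz
    -- `x` has a neighbour of its color that is not adjacent to `y`: otherwise the neighbours of
    -- `x` would leave no room for `z` among those of `y`.
    have hex : ∃ x', G.Adj x x' ∧ c x' = c x ∧ x' ≠ y ∧ ¬ G.Adj x' y := by
      by_contra! hno
      have hsub : insert z (insert x ((Finset.univ.filter fun w => G.Adj x w ∧ c w = c x).erase y))
          ⊆ Finset.univ.filter fun w => G.Adj y w ∧ c w = c y := by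
        intro w hw
        simp only [Finset.mem_insert, Finset.mem_erase, Finset.mem_filter, Finset.mem_univ,
          true_and] at hw ⊢
        rcases hw with rfl | rfl | ⟨h1, h2, h3⟩
        · exact ⟨hyz, cyz⟩
        · exact ⟨hxy.symm, cxy⟩
        · exact ⟨(hno w h2 h3 h1).symm, h3.trans cxy⟩
      have hcard := Finset.card_le_card hsub
      rw [card, Finset.card_insert_of_notMem, Finset.card_insert_of_notMem,
        Finset.card_erase_of_mem, card] at hcard
      · have : 0 < (Finset.univ.filter fun w => G.Adj x w ∧ c w = c x).card :=
          Finset.card_pos.2 ⟨y, by simp [hxy, cxy]⟩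
        rw [card] at this
        omega
      · simp [hxy, cxy]
      · simp
      · simp only [Finset.mem_insert, Finset.mem_erase, Finset.mem_filter, Finset.mem_univ,
          true_and, not_or, not_and]
        exact ⟨hxz.symm, fun _ h => absurd h hnxz⟩
    obtain ⟨x', hxx', cx', hx'y, hnx'y⟩ := hex
    have hyB : ¬ Relation.ReflTransGen (R x) x' y := by
      intro h
      obtain ⟨p, hp⟩ := walk x x' y hxx'.ne' h
      exact hnx'y (hG.adj_of_walk p hp hxx' hxy hx'y)
    have hsub : B x x' ⊂ B y x := by
      rw [Finset.ssubset_iff]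
      refine ⟨x, ?_, ?_⟩
      · intro h
        simp only [B, Finset.mem_filter, Finset.mem_univ, true_and] at h
        rcases Relation.ReflTransGen.cases_tail h with h | ⟨_, _, h⟩
        · exact hxx'.ne h
        · exact h.2.2 rfl
      · intro u hu
        simp only [B, Finset.mem_insert, Finset.mem_filter, Finset.mem_univ, true_and] at hu ⊢
        rcases hu with rfl | hu
        · exact Relation.ReflTransGen.refl
        · refine Relation.ReflTransGen.head ⟨hxx', cx'.trans cxy, hx'y⟩ ?_
          induction hu with
          | refl => exact Relation.ReflTransGen.refl
          | tail h1 h2 ih =>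
            refine ih.tail ⟨h2.1, h2.2.1.trans cxy, ?_⟩
            rintro rfl
            exact hyB (h1.tail h2)
    exact ih _ (hN ▸ Finset.card_lt_card hsub) x' x y rfl hxx'.symm hxy hx'y cx' cxy.symm hnx'y
  exact main _ x y z rfl hxy hyz hxz cxy cyz hnxz

/-- The color classes of an exact coloring of a block graph are disjoint unions of cliques with
`d + 1` vertices. -/
theorem IsBlockGraph.isClique_supp_of_isExactColoring [Finite V] (hG : G.IsBlockGraph) {k d : ℕ}
    {c : V → Fin k} (hc : G.IsExactColoring d c) (i : Fin k)
    (K : (G.induce {v : V | c v = i}).ConnectedComponent) :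
    (G.induce {v : V | c v = i}).IsClique K.supp ∧ K.supp.ncard = d + 1 := by
  have reach : ∀ a b : {v : V | c v = i}, (G.induce {v : V | c v = i}).Reachable a b →
      a = b ∨ G.Adj a b := by
    intro a b hab
    rw [reachable_iff_reflTransGen] at hab
    induction hab with
    | refl => exact Or.inl rfl
    | @tail b e _ h ih =>
      have h : G.Adj b e := h
      by_cases hae : a = e
      · exact Or.inl hae
      rcases ih with rfl | ih
      · exact Or.inr h
      · exact Or.inr (hG.adj_trans_of_isExactColoring hc ih h (fun e => hae (Subtype.ext e))
          (a.2.trans b.2.symm) (e.2.trans b.2.symm))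
  constructor
  · intro a ha b hb hab
    exact (reach a b (ConnectedComponent.exact (ha.trans hb.symm))).resolve_left hab
  · obtain ⟨a, rfl⟩ := K.exists_rep
    have himg : Subtype.val '' ((G.induce {v : V | c v = i}).connectedComponentMk a).supp =
        insert (a : V) {w | G.Adj a w ∧ c w = c a} := by
      ext w
      simp only [Set.mem_image, ConnectedComponent.mem_supp_iff, Set.mem_insert_iff,
        Set.mem_ofPred_eq]
      constructor
      · rintro ⟨b, hb, rfl⟩
        rcases reach a b (ConnectedComponent.exact hb.symm) with rfl | h
        · exact Or.inl rfl
        · exact Or.inr ⟨h, b.2.trans a.2.symm⟩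
      · rintro (rfl | ⟨h, hw⟩)
        · exact ⟨a, rfl, rfl⟩
        · refine ⟨⟨w, hw.trans a.2⟩, ?_, rfl⟩
          have hadj : (G.induce {v : V | c v = i}).Adj ⟨w, hw.trans a.2⟩ a := h.symm
          exact ConnectedComponent.sound hadj.reachable
    have hcard := congrArg Set.ncard himg
    have hd : {w | G.Adj a w ∧ c w = c a}.ncard = d := by
      rw [Set.ncard, hc a]
      rfl
    rw [Set.ncard_image_of_injective _ Subtype.val_injective, Set.ncard_insert_of_notMem (by simp),
      hd] at hcard
    exact hcard

end SimpleGraph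

/-! ### Search orders of block graphs -/

namespace SimpleGraph

open Finset

universe u

variable {V : Type u} {G : SimpleGraph V} {idx par : V → ℕ}

/-- The result of a breadth-first search through all components of `G`: `idx v` is the position
of `v` in the queue, and `par v` is the position of the vertex from which `v` was found, or `0` if
the search of a component started at `v`. -/
structure IsSearchOrder (G : SimpleGraph V) (idx par : V → ℕ) : Prop where
  injective : Function.Injective idx
  pos : ∀ v, 0 < idx v
  exists_parent : ∀ v, par v ≠ 0 → ∃ p, idx p = par v ∧ G.Adj p v ∧ par v < idx v
  par_le : ∀ v w, par v ≠ 0 → G.Adj v w → par v ≤ idx w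
  root : ∀ r v w, par r = 0 → G.Adj v w → idx v < idx r → idx w < idx r

namespace IsSearchOrder

theorem par_lt (h : G.IsSearchOrder idx par) (v : V) : par v < idx v := by
  by_cases hv : par v = 0
  · rw [hv]
    exact h.pos v
  · obtain ⟨p, -, -, hp⟩ := h.exists_parent v hv
    exact hp

theorem adj_of_par_eq (h : G.IsSearchOrder idx par) {v w : V} (hw : par w = idx v) :
    G.Adj v w := by
  obtain ⟨p, hp, hpw, -⟩ := h.exists_parent w (hw ▸ (h.pos v).ne')
  rwa [h.injective (hp.trans hw)] at hpw

/-- Two vertices not separated by a root are connected through vertices that are not found later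
than both. -/
theorem exists_walk (h : G.IsSearchOrder idx par) (u v : V) (huv : idx u ≤ idx v)
    (hr : ∀ r, par r = 0 → idx u < idx r → idx v < idx r) :
    ∃ p : G.Walk u v, ∀ x ∈ p.support, idx x ≤ idx v := by
  induction hN : idx v using Nat.strong_induction_on generalizing u v with
  | _ N ih =>
  subst hN
  rcases huv.eq_or_lt with huv | huv
  · obtain rfl := h.injective huv
    exact ⟨Walk.nil, by simp⟩
  have hv : par v ≠ 0 := fun h0 => lt_irrefl _ (hr v h0 huv)
  obtain ⟨p, hp, hpv, hlt⟩ := h.exists_parent v hv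
  rw [← hp] at hlt
  rcases le_or_gt (idx u) (idx p) with hup | hpu
  · obtain ⟨q, hq⟩ := ih _ hlt u p hup (fun r h0 h1 => hlt.trans (hr r h0 h1)) rfl
    refine ⟨q.concat hpv, fun x hx => ?_⟩
    rw [Walk.support_concat, List.mem_append, List.mem_singleton] at hx
    rcases hx with hx | rfl
    · exact (hq x hx).trans hlt.le
    · exact le_rfl
  · obtain ⟨q, hq⟩ := ih _ huv p u hpu.le
      (fun r h0 h1 => huv.trans (h.root r p v h0 hpv h1)) rfl
    refine ⟨q.reverse.concat hpv, fun x hx => ?_⟩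
    rw [Walk.support_concat, List.mem_append, List.mem_singleton, Walk.support_reverse,
      List.mem_reverse] at hx
    rcases hx with hx | rfl
    · exact (hq x hx).trans huv.le
    · exact le_rfl

/-- In a block graph, every edge joins a vertex to its parent or two vertices with the same
parent. -/
theorem par_eq_or [Finite V] (h : G.IsSearchOrder idx par) (hG : G.IsBlockGraph) {v w : V}
    (hvw : G.Adj v w) (hlt : idx v < idx w) : par w = idx v ∨ par w = par v ∧ par v ≠ 0 := by
  induction hN : idx w using Nat.strong_induction_on generalizing v w with
  | _ N ih =>
  subst hN
  have hw : par w ≠ 0 := fun h0 => lt_irrefl _ (h.root w v w h0 hvw hlt)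
  obtain ⟨p, hp, hpw, -⟩ := h.exists_parent w hw
  have hpv : idx p ≤ idx v := hp ▸ h.par_le w v hw hvw.symm
  rcases hpv.eq_or_lt with hpv | hpv
  · exact Or.inl (hp.symm.trans hpv)
  right
  -- The parent `p` of `w` and `v` are joined by a walk through vertices found before `w`.
  obtain ⟨q, hq⟩ := h.exists_walk p v hpv.le (fun r h0 h1 => hlt.trans (h.root r p w h0 hpw h1))
  have hadj : G.Adj p v := hG.adj_of_walk q (fun hx => absurd (hq w hx) (not_le.2 hlt)) hpw.symm
    hvw.symm (fun e => hpv.ne (congrArg idx e))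
  rcases ih _ hlt hadj hpv rfl with hpar | ⟨hpar, h0⟩
  · rw [hpar, hp]
    exact ⟨rfl, hw⟩
  -- Otherwise `p` and `v` have a common parent, which is adjacent to `w` and found before `p`.
  · exfalso
    obtain ⟨o, ho, hop, hlt'⟩ := h.exists_parent p h0
    have hov : G.Adj o v := h.adj_of_par_eq (hpar.trans ho.symm)
    have how : G.Adj o w := hG.adj_of_diamond hadj hop.symm hpw hov.symm hvw
      (by rintro rfl; omega)
    have := h.par_le w o hw how.symm
    omega

end IsSearchOrder

open scoped Classical in
/-- The vertices of the block that contains `v` and its parent, except the parent. -/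
noncomputable def siblings [Fintype V] (G : SimpleGraph V) (par : V → ℕ) (v : V) : Finset V :=
  {w | par w = par v ∧ (w = v ∨ G.Adj v w)}

/-- The vertex `v` is the first one of its block after its parent. -/
def IsHead [Fintype V] (G : SimpleGraph V) (idx par : V → ℕ) (v : V) : Prop :=
  par v ≠ 0 ∧ ∀ w ∈ G.siblings par v, idx v ≤ idx w

theorem mem_siblings [Fintype V] {v w : V} :
    w ∈ G.siblings par v ↔ par w = par v ∧ (w = v ∨ G.Adj v w) := by
  simp [siblings]

theorem self_mem_siblings [Fintype V] (v : V) : v ∈ G.siblings par v := by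
  simp [mem_siblings]

namespace IsSearchOrder

variable [Fintype V]

theorem adj_cases (h : G.IsSearchOrder idx par) (hG : G.IsBlockGraph) {v w : V}
    (hvw : G.Adj v w) :
    par w = idx v ∨ par v = idx w ∨ par w = par v ∧ par v ≠ 0 ∧ w ∈ G.siblings par v := by
  rw [mem_siblings]
  rcases lt_trichotomy (idx v) (idx w) with hlt | heq | hlt
  · have := h.par_eq_or hG hvw hlt
    tauto
  · exact absurd (h.injective heq) hvw.ne
  · have h1 := h.par_eq_or hG hvw.symm hlt
    rcases h1 with h1 | ⟨h1, h2⟩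
    · tauto
    · rw [h1]
      tauto

theorem par_ne_zero_of_mem_siblings (h : G.IsSearchOrder idx par) (hG : G.IsBlockGraph)
    {v w : V} (hw : w ∈ G.siblings par v) (hne : w ≠ v) : par v ≠ 0 := by
  rw [mem_siblings] at hw
  obtain ⟨h1, h2⟩ := hw
  have h2 := h2.resolve_left hne
  have := h.adj_cases hG h2
  have := h.par_lt v
  have := h.par_lt w
  omega

theorem adj_of_mem_siblings (h : G.IsSearchOrder idx par) (hG : G.IsBlockGraph)
    {v x y : V} (hx : x ∈ G.siblings par v) (hy : y ∈ G.siblings par v) (hxy : x ≠ y) :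
    G.Adj x y := by
  by_cases hxv : x = v
  · subst hxv
    exact (mem_siblings.1 hy).2.resolve_left hxy.symm
  by_cases hyv : y = v
  · subst hyv
    exact ((mem_siblings.1 hx).2.resolve_left hxy).symm
  have h0 := h.par_ne_zero_of_mem_siblings hG hx hxv
  obtain ⟨p, hp, -, -⟩ := h.exists_parent v h0
  rw [mem_siblings] at hx hy
  exact hG.adj_of_diamond (h.adj_of_par_eq hp.symm).symm (hx.2.resolve_left hxv)
    (hy.2.resolve_left hyv) (h.adj_of_par_eq (hx.1.trans hp.symm))
    (h.adj_of_par_eq (hy.1.trans hp.symm)) hxy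

theorem siblings_eq (h : G.IsSearchOrder idx par) (hG : G.IsBlockGraph)
    {v w : V} (hw : w ∈ G.siblings par v) : G.siblings par w = G.siblings par v := by
  have hw' := mem_siblings.1 hw
  have hv : v ∈ G.siblings par w := by
    rw [mem_siblings]
    exact ⟨hw'.1.symm, hw'.2.imp Eq.symm Adj.symm⟩
  ext x
  constructor
  · intro hx
    rw [mem_siblings]
    refine ⟨(mem_siblings.1 hx).1.trans hw'.1, ?_⟩
    by_cases hxv : x = v
    · exact Or.inl hxv
    · exact Or.inr (h.adj_of_mem_siblings hG hv hx (Ne.symm hxv))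
  · intro hx
    rw [mem_siblings]
    refine ⟨(mem_siblings.1 hx).1.trans hw'.1.symm, ?_⟩
    by_cases hxv : x = w
    · exact Or.inl hxv
    · exact Or.inr (h.adj_of_mem_siblings hG hw hx (Ne.symm hxv))

theorem exists_isHead (h : G.IsSearchOrder idx par) (hG : G.IsBlockGraph) {v : V}
    (hv : par v ≠ 0) : ∃ w ∈ G.siblings par v, G.IsHead idx par w := by
  obtain ⟨w, hw, hmin⟩ := exists_min_image (G.siblings par v) idx ⟨v, self_mem_siblings v⟩
  refine ⟨w, hw, ?_, ?_⟩
  · rwa [(mem_siblings.1 hw).1]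
  · rwa [h.siblings_eq hG hw]

theorem isHead_unique (h : G.IsSearchOrder idx par) (hG : G.IsBlockGraph) {v w : V}
    (hv : G.IsHead idx par v) (hw : G.IsHead idx par w) (hvw : w ∈ G.siblings par v) :
    v = w := by
  apply h.injective
  apply le_antisymm (hv.2 w hvw) (hw.2 v _)
  rw [h.siblings_eq hG hvw]
  exact self_mem_siblings v

end IsSearchOrder

/-! ### The counting criterion -/

section Criterion

variable [Fintype V]

/-- The number of vertices in the block of `v` below its parent that are not covered by a clique
of a lower block, if `cov w` is the number of lower blocks covering `w`. -/
noncomputable def freeCount (G : SimpleGraph V) (par cov : V → ℕ) (v : V) : ℕ :=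
  #{w ∈ G.siblings par v | cov w = 0}

/-- The number of vertices in the block of `v` below its parent that are covered by a clique of
a lower block. -/
noncomputable def coveredCount (G : SimpleGraph V) (par cov : V → ℕ) (v : V) : ℕ :=
  #{w ∈ G.siblings par v | cov w ≠ 0}

open scoped Classical in
/-- `cov v` is the number of blocks with parent `v` whose free vertices can be divided into
cliques of `d + 1` vertices only together with `v`. -/
def IsCoverCount (G : SimpleGraph V) (d : ℕ) (idx par cov : V → ℕ) : Prop :=
  ∀ v, cov v = #{h | G.IsHead idx par h ∧ par h = idx v ∧ G.freeCount par cov h % (d + 1) = d}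

/-- The conditions on the numbers of free and covered vertices that decide whether an exact
`(k, d)`-coloring exists. A root has to be covered by a lower block, and no vertex by two of them.
The last condition says that at most `k` cliques meet a block: the parent lies in one clique, which
may use up the `d` left-over free vertices, each covered vertex lies in one of its own, and the free
vertices fill the other ones. -/
structure IsFeasible (G : SimpleGraph V) (k d : ℕ) (idx par cov : V → ℕ) : Prop where
  root : ∀ v, par v = 0 → cov v ≠ 0
  le_one : ∀ v, cov v ≤ 1
  mod : ∀ v, G.IsHead idx par v →
    G.freeCount par cov v % (d + 1) = 0 ∨ G.freeCount par cov v % (d + 1) = d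
  lt : ∀ v, G.IsHead idx par v →
    G.coveredCount par cov v + G.freeCount par cov v / (d + 1) < k

end Criterion

end SimpleGraph

/-! ### Exact colorings satisfy the criterion -/

namespace SimpleGraph

open Finset

universe u

variable {V : Type u} {G : SimpleGraph V} {idx par cov : V → ℕ} [Fintype V] {k d : ℕ}
  {c : V → Fin k}

/-- Some neighbour of `v` with the color of `v` is not a child of `v`; for an exact coloring this
says that the monochromatic clique of `v` lies in the block of `v` and its parent. -/
def IsUp (G : SimpleGraph V) (idx par : V → ℕ) (c : V → Fin k) (v : V) : Prop :=
  ∃ w, G.Adj v w ∧ c w = c v ∧ par w ≠ idx v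

namespace IsSearchOrder

/-- If one neighbour of `v` with the color of `v` is a child of `v`, all of them lie in the block of
this child. -/
theorem mem_siblings_of_color_eq (h : G.IsSearchOrder idx par) (hG : G.IsBlockGraph)
    (hc : G.IsExactColoring d c) {v w u : V} (hw : G.Adj v w) (cw : c w = c v)
    (hpw : par w = idx v) (hu : G.Adj v u) (cu : c u = c v) : u ∈ G.siblings par w := by
  by_cases hwu : u = w
  · exact hwu ▸ self_mem_siblings _
  have hadj : G.Adj w u :=
    hG.adj_trans_of_isExactColoring hc hw.symm hu (Ne.symm hwu) cw cu
  have h1 := h.adj_cases hG hadj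
  have h2 := h.adj_cases hG hu
  have := h.par_lt v
  have := h.par_lt w
  have := h.par_lt u
  by_cases hm : u ∈ G.siblings par w
  · exact hm
  exfalso
  simp only [hm, and_false, or_false] at h1
  rcases h1 with h1 | h1
  · omega
  · exact hu.ne (h.injective (hpw.symm.trans h1))

theorem par_ne_of_isUp (h : G.IsSearchOrder idx par) (hG : G.IsBlockGraph)
    (hc : G.IsExactColoring d c) {v u : V} (hv : G.IsUp idx par c v) (hu : G.Adj v u)
    (cu : c u = c v) : par u ≠ idx v := by
  obtain ⟨w, hw, cw, hpw⟩ := hv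
  intro hpu
  have := h.mem_siblings_of_color_eq hG hc hu cu hpu hw cw
  exact hpw ((mem_siblings.1 this).1.trans hpu)

/-- The numbers of vertices of each color in a block `S` with parent `v`: the colors other than
that of `v` occur at `d + 1` vertices whose clique lies in the block, or at one vertex whose
clique does not, or not at all. -/
theorem card_color_cases (h : G.IsSearchOrder idx par) (hG : G.IsBlockGraph)
    (hc : G.IsExactColoring d c) {v b : V} (hb : par b = idx v) (P : V → Prop) [DecidablePred P]
    (hP : ∀ w ∈ G.siblings par b, P w ↔ G.IsUp idx par c w) {i : Fin k} (hi : i ≠ c v) :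
    ∃ a, #{w ∈ G.siblings par b | P w ∧ c w = i} = (d + 1) * a ∧
      #{w ∈ G.siblings par b | ¬ P w ∧ c w = i} + a ≤ 1 := by
  classical
  have hpar : ∀ w ∈ G.siblings par b, par w = idx v := fun w hw => (mem_siblings.1 hw).1.trans hb
  by_cases hex : ∃ w ∈ G.siblings par b, P w ∧ c w = i
  · obtain ⟨w, hw, hPw, rfl⟩ := hex
    have hup : ∀ x ∈ G.siblings par b, c x = c w → P x := by
      intro x hx cx
      by_cases hxw : x = w
      · rwa [hxw]
      · refine (hP x hx).2 ⟨w, h.adj_of_mem_siblings hG hx hw hxw, cx.symm, ?_⟩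
        have := h.par_lt x
        rw [hpar w hw, ← hpar x hx]
        exact this.ne
    refine ⟨1, ?_, ?_⟩
    · have : (G.siblings par b).filter (fun x => P x ∧ c x = c w) =
          insert w (univ.filter fun u => G.Adj w u ∧ c u = c w) := by
        ext x
        simp only [mem_filter, mem_insert, mem_univ, true_and]
        constructor
        · rintro ⟨hx, -, cx⟩
          by_cases hxw : x = w
          · exact Or.inl hxw
          · exact Or.inr ⟨h.adj_of_mem_siblings hG hw hx (Ne.symm hxw), cx⟩
        · rintro (rfl | ⟨hx, cx⟩)
          · exact ⟨hw, hPw, rfl⟩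
          · have hxS : x ∈ G.siblings par b := by
              rcases h.adj_cases hG hx with h1 | h1 | ⟨-, -, h1⟩
              · exact absurd h1 (h.par_ne_of_isUp hG hc ((hP w hw).1 hPw) hx cx)
              · rw [hpar w hw] at h1
                exact absurd (cx.symm.trans (congrArg c (h.injective h1).symm)) hi
              · rwa [← h.siblings_eq hG hw]
            exact ⟨hxS, hup x hxS cx, cx⟩
      rw [this, card_insert_of_notMem (by simp), isExactColoring_iff_card_eq.1 hc, mul_one]
    · rw [card_eq_zero.2]
      rw [filter_eq_empty_iff]
      rintro x hx ⟨h1, h2⟩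
      exact h1 (hup x hx h2)
  · refine ⟨0, ?_, ?_⟩
    · rw [mul_zero, card_eq_zero, filter_eq_empty_iff]
      exact fun x hx h1 => hex ⟨x, hx, h1⟩
    · rw [add_zero, card_le_one]
      intro x hx y hy
      rw [mem_filter] at hx hy
      by_contra hxy
      refine hx.2.1 ((hP x hx.1).2 ⟨y, h.adj_of_mem_siblings hG hx.1 hy.1 hxy,
        hy.2.2.trans hx.2.2.symm, ?_⟩)
      have := h.par_lt x
      rw [hpar y hy.1, ← hpar x hx.1]
      exact this.ne

/-- The color of the parent `v` of a block occurs at `d` other vertices of the block if the clique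
of `v` lies in the block, and at no other vertex otherwise. -/
theorem card_parent_color (h : G.IsSearchOrder idx par) (hG : G.IsBlockGraph)
    (hc : G.IsExactColoring d c) {v b : V} (hb : par b = idx v) (P : V → Prop) [DecidablePred P]
    (hP : ∀ w ∈ G.siblings par b, P w ↔ G.IsUp idx par c w) :
    #{w ∈ G.siblings par b | ¬ P w ∧ c w = c v} = 0 ∧
    #{w ∈ G.siblings par b | P w ∧ c w = c v} =
      (open scoped Classical in if ∃ w ∈ G.siblings par b, c w = c v then d else 0) := by
  classical
  have hpar : ∀ w ∈ G.siblings par b, par w = idx v := fun w hw => (mem_siblings.1 hw).1.trans hb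
  have hadj : ∀ w ∈ G.siblings par b, G.Adj v w := fun w hw => h.adj_of_par_eq (hpar w hw)
  have hup : ∀ x ∈ G.siblings par b, c x = c v → P x := by
    intro x hx cx
    refine (hP x hx).2 ⟨v, (hadj x hx).symm, cx.symm, ?_⟩
    have h1 := h.par_lt x
    have h2 := h.par_lt v
    rw [hpar x hx] at h1
    omega
  constructor
  · rw [card_eq_zero, filter_eq_empty_iff]
    rintro x hx ⟨h1, h2⟩
    exact h1 (hup x hx h2)
  split_ifs with hex
  · obtain ⟨w, hw, cw⟩ := hex
    rw [← isExactColoring_iff_card_eq.1 hc v]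
    congr 1
    ext x
    simp only [mem_filter, mem_univ, true_and]
    constructor
    · rintro ⟨hx, -, cx⟩
      exact ⟨hadj x hx, cx⟩
    · rintro ⟨hx, cx⟩
      have := h.mem_siblings_of_color_eq hG hc (hadj w hw) cw (hpar w hw) hx cx
      rw [h.siblings_eq hG hw] at this
      exact ⟨this, hup x this cx, cx⟩
  · rw [card_eq_zero, filter_eq_empty_iff]
    exact fun x hx h1 => hex ⟨x, hx, h1.2⟩

/-- Summing over the colors: a block with parent `v` covers `v` exactly if its number of free
vertices is `d` modulo `d + 1`, and it meets at most `k` monochromatic cliques. -/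
theorem counts_of_isExactColoring (h : G.IsSearchOrder idx par) (hG : G.IsBlockGraph) (hd : 0 < d)
    (hc : G.IsExactColoring d c) {v b : V} (hb : par b = idx v)
    (hcov : ∀ w ∈ G.siblings par b, cov w = 0 ↔ G.IsUp idx par c w) :
    (G.freeCount par cov b % (d + 1) = 0 ∨ G.freeCount par cov b % (d + 1) = d) ∧
    (G.freeCount par cov b % (d + 1) = d ↔ ∃ w ∈ G.siblings par b, c w = c v) ∧
    G.coveredCount par cov b + G.freeCount par cov b / (d + 1) < k := by
  classical
  have hcol := fun i hi => h.card_color_cases hG hc hb (fun w => cov w = 0) hcov (i := i) hi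
  choose! a ha hE using hcol
  obtain ⟨hE0, hU0⟩ := h.card_parent_color hG hc hb (fun w => cov w = 0) hcov
  set S := G.siblings par b
  set m := if ∃ w ∈ S, c w = c v then d else 0 with hm
  have hF : G.freeCount par cov b = m + (d + 1) * ∑ i ∈ univ.erase (c v), a i := by
    rw [freeCount, card_eq_sum_card_fiberwise (f := c) (t := univ)
      (fun _ _ => mem_coe.2 (mem_univ _)), ← add_sum_erase _ _ (mem_univ (c v)), mul_sum]
    congr 1
    · rw [filter_filter]
      exact hU0
    · refine sum_congr rfl fun i hi => ?_
      rw [filter_filter]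
      exact ha i (ne_of_mem_erase hi)
  have hC : G.coveredCount par cov b + ∑ i ∈ univ.erase (c v), a i ≤ k - 1 := by
    rw [coveredCount, card_eq_sum_card_fiberwise (f := c) (t := univ)
      (fun _ _ => mem_coe.2 (mem_univ _)), ← add_sum_erase _ _ (mem_univ (c v)), filter_filter, hE0,
      zero_add, ← sum_add_distrib]
    have hle : ∀ i ∈ univ.erase (c v),
        #{w ∈ {w ∈ S | cov w ≠ 0} | c w = i} + a i ≤ 1 := by
      intro i hi
      rw [filter_filter]
      exact hE i (ne_of_mem_erase hi)
    refine (sum_le_sum hle).trans ?_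
    simp [card_erase_of_mem]
  have hk : 0 < k := (c v).pos
  have hmd : m < d + 1 := by
    rw [hm]
    split_ifs <;> omega
  have hmod : G.freeCount par cov b % (d + 1) = m := by
    rw [hF, Nat.add_mul_mod_self_left, Nat.mod_eq_of_lt hmd]
  have hdiv : G.freeCount par cov b / (d + 1) = ∑ i ∈ univ.erase (c v), a i := by
    rw [hF, Nat.add_mul_div_left _ _ (by omega), Nat.div_eq_of_lt hmd, zero_add]
  rw [hmod, hdiv]
  refine ⟨?_, ?_, by omega⟩
  · rw [hm]
    split_ifs <;> simp
  · rw [hm]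
    split_ifs with hex
    · simpa using hex
    · simp only [hex, iff_false]
      omega

/-- In an exact coloring, `cov v` counts the blocks below `v` that contain the monochromatic
clique of `v`. -/
theorem cov_of_isExactColoring (h : G.IsSearchOrder idx par) (hG : G.IsBlockGraph) (hd : 0 < d)
    (hcov : G.IsCoverCount d idx par cov) (hc : G.IsExactColoring d c) (v : V) :
    (cov v = 0 ↔ G.IsUp idx par c v) ∧ cov v ≤ 1 := by
  classical
  obtain ⟨N, hN⟩ : ∃ N, ∀ w, idx w ≤ N :=
    ⟨∑ w, idx w, fun w => single_le_sum (f := idx) (fun _ _ => Nat.zero_le _) (mem_univ w)⟩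
  induction hM : N - idx v using Nat.strong_induction_on generalizing v with
  | _ M ih =>
  subst hM
  have hiff : ∀ b, par b = idx v →
      (G.freeCount par cov b % (d + 1) = d ↔ ∃ w ∈ G.siblings par b, c w = c v) := by
    intro b hb
    refine (h.counts_of_isExactColoring hG hd hc hb fun w hw => (ih _ ?_ w rfl).1).2.1
    have h1 := h.par_lt w
    rw [(mem_siblings.1 hw).1, hb] at h1
    have := hN w
    omega
  have hnon : ∃ w, G.Adj v w ∧ c w = c v := by
    have h1 : 0 < #{w | G.Adj v w ∧ c w = c v} := by
      rwa [isExactColoring_iff_card_eq.1 hc]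
    obtain ⟨w, hw⟩ := card_pos.1 h1
    exact ⟨w, (mem_filter.1 hw).2⟩
  rw [hcov v]
  constructor
  · rw [card_eq_zero, filter_eq_empty_iff]
    constructor
    · intro hno
      obtain ⟨w, hw, cw⟩ := hnon
      refine ⟨w, hw, cw, fun hpw => ?_⟩
      obtain ⟨b, hb, hbh⟩ := h.exists_isHead hG (v := w) (hpw ▸ (h.pos v).ne')
      have hpb : par b = idx v := (mem_siblings.1 hb).1.trans hpw
      refine hno (mem_univ b) ⟨hbh, hpb, (hiff b hpb).2 ⟨w, ?_, cw⟩⟩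
      rw [h.siblings_eq hG hb]
      exact self_mem_siblings w
    · rintro hup b - ⟨hbh, hpb, hbd⟩
      obtain ⟨w, hw, cw⟩ := (hiff b hpb).1 hbd
      have hpw : par w = idx v := (mem_siblings.1 hw).1.trans hpb
      exact h.par_ne_of_isUp hG hc hup (h.adj_of_par_eq hpw) cw hpw
  · rw [card_le_one]
    intro b hb b' hb'
    simp only [mem_filter, mem_univ, true_and] at hb hb'
    obtain ⟨w, hw, cw⟩ := (hiff b hb.2.1).1 hb.2.2
    obtain ⟨w', hw', cw'⟩ := (hiff b' hb'.2.1).1 hb'.2.2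
    have hpw : par w = idx v := (mem_siblings.1 hw).1.trans hb.2.1
    have hpw' : par w' = idx v := (mem_siblings.1 hw').1.trans hb'.2.1
    have hm := h.mem_siblings_of_color_eq hG hc (h.adj_of_par_eq hpw) cw hpw
      (h.adj_of_par_eq hpw') cw'
    refine h.isHead_unique hG hb.1 hb'.1 ?_
    rw [← h.siblings_eq hG hw, ← h.siblings_eq hG hm, h.siblings_eq hG hw']
    exact self_mem_siblings b'

theorem isFeasible_of_isExactColoring (h : G.IsSearchOrder idx par) (hG : G.IsBlockGraph)
    (hd : 0 < d) (hcov : G.IsCoverCount d idx par cov) (hc : G.IsExactColoring d c) :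
    G.IsFeasible k d idx par cov := by
  have hup := h.cov_of_isExactColoring hG hd hcov hc
  have hpar : ∀ b, G.IsHead idx par b → ∃ p, par b = idx p := fun b hb => by
    obtain ⟨p, hp, -, -⟩ := h.exists_parent b hb.1
    exact ⟨p, hp.symm⟩
  refine ⟨fun v hv h0 => ?_, fun v => (hup v).2, fun b hb => ?_, fun b hb => ?_⟩
  rotate_left
  · obtain ⟨p, hp⟩ := hpar b hb
    exact (h.counts_of_isExactColoring hG hd hc hp fun w _ => (hup w).1).1
  · obtain ⟨p, hp⟩ := hpar b hb
    exact (h.counts_of_isExactColoring hG hd hc hp fun w _ => (hup w).1).2.2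
  obtain ⟨w, hw, -, hpw⟩ := (hup v).1.1 h0
  have h1 := h.adj_cases hG hw
  have := h.pos w
  omega

end IsSearchOrder

end SimpleGraph

/-! ### The criterion yields an exact coloring -/

namespace SimpleGraph

open Finset

universe u

/-- Recursion along a measure `μ`. -/
theorem exists_eq_of_forall_lt {V : Type u} (μ : V → ℕ) (Φ : V → (V → ℕ) → ℕ)
    (hΦ : ∀ v f g, (∀ w, μ w < μ v → f w = g w) → Φ v f = Φ v g) :
    ∃ f : V → ℕ, ∀ v, f v = Φ v f := by
  classical
  let F : ∀ v, (∀ w, μ w < μ v → ℕ) → ℕ :=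
    fun v rec => Φ v (fun w => if hw : μ w < μ v then rec w hw else 0)
  refine ⟨(measure μ).wf.fix F, fun v => ?_⟩
  rw [WellFounded.fix_eq]
  refine hΦ _ _ _ fun w hw => ?_
  exact dif_pos hw

/-- The ranks of the elements of `A` are the numbers below `#A`, each occurring once. -/
theorem card_filter_rank {V : Type u} {idx : V → ℕ} (hidx : Function.Injective idx) (A : Finset V)
    (Q : ℕ → Prop) [DecidablePred Q] :
    #{w ∈ A | Q #{x ∈ A | idx x < idx w}} = #{r ∈ range #A | Q r} := by
  classical
  set rank : V → ℕ := fun w => #{x ∈ A | idx x < idx w} with hrank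
  have hlt : ∀ v ∈ A, ∀ w, idx v < idx w → rank v < rank w := by
    intro v hv w hvw
    refine card_lt_card (ssubset_iff.2 ⟨v, by simp, fun x hx => ?_⟩)
    rw [mem_insert, mem_filter] at hx
    rw [mem_filter]
    rcases hx with rfl | ⟨h1, h2⟩
    · exact ⟨hv, hvw⟩
    · exact ⟨h1, h2.trans hvw⟩
  have hinj : Set.InjOn rank A := by
    intro v hv w hw hvw
    apply hidx
    rcases lt_trichotomy (idx v) (idx w) with hlt' | heq | hlt'
    · exact absurd hvw (hlt v hv w hlt').ne
    · exact heq
    · exact absurd hvw (hlt w hw v hlt').ne'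
  have himg : A.image rank = range #A := by
    apply eq_of_subset_of_card_le
    · intro r hr
      obtain ⟨w, hw, rfl⟩ := mem_image.1 hr
      exact mem_range.2 (card_lt_card (filter_ssubset.2 ⟨w, hw, lt_irrefl _⟩))
    · rw [card_range, card_image_of_injOn hinj]
  rw [← himg, filter_image, card_image_of_injOn]
  exact hinj.mono (coe_subset.2 (filter_subset _ _))

theorem card_filter_add_div_eq {d F s q : ℕ} (hs : s ≤ d + 1) (hF : (q + 1) * (d + 1) ≤ F + s) :
    #{r ∈ range F | (r + s) / (d + 1) = q} = if q = 0 then d + 1 - s else d + 1 := by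
  have : (range F).filter (fun r => (r + s) / (d + 1) = q) =
      Ico (q * (d + 1) - s) ((q + 1) * (d + 1) - s) := by
    ext r
    rw [mem_filter, mem_range, mem_Ico, Nat.div_eq_iff (by omega)]
    rw [add_mul] at *
    omega
  rw [this, Nat.card_Ico]
  split_ifs with hq
  · subst hq
    omega
  · have : d + 1 ≤ q * (d + 1) := Nat.le_mul_of_pos_left _ (by omega)
    rw [add_mul]
    omega

theorem exactChromaticNumber_le_iff {V : Type u} {G : SimpleGraph V} {k d : ℕ} :
    G.exactChromaticNumber d ≤ (k : ℕ∞) ↔ ∃ c : V → Fin k, G.IsExactColoring d c := by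
  constructor
  · intro hle
    have hne : {m : ℕ∞ | ∃ k : ℕ, m = k ∧ ∃ c : V → Fin k, G.IsExactColoring d c}.Nonempty := by
      by_contra hemp
      rw [Set.not_nonempty_iff_eq_empty] at hemp
      rw [exactChromaticNumber, hemp, sInf_empty] at hle
      exact absurd hle (by simp)
    obtain ⟨j, hj, c, hc⟩ := csInf_mem hne
    rw [exactChromaticNumber, hj, Nat.cast_le] at hle
    refine ⟨fun v => (c v).castLE hle, fun v => ?_⟩
    simpa using hc v
  · rintro ⟨c, hc⟩
    exact sInf_le ⟨k, rfl, c, hc⟩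

variable {V : Type u} {G : SimpleGraph V} {idx par cov : V → ℕ} [Fintype V] {k d : ℕ}

theorem exists_isCoverCount (d : ℕ) (h : G.IsSearchOrder idx par) :
    ∃ cov, G.IsCoverCount d idx par cov := by
  classical
  obtain ⟨N, hN⟩ : ∃ N, ∀ w, idx w ≤ N :=
    ⟨∑ w, idx w, fun w => single_le_sum (f := idx) (fun _ _ => Nat.zero_le _) (mem_univ w)⟩
  refine exists_eq_of_forall_lt (fun v => N - idx v) (fun v cov =>
    #{b | G.IsHead idx par b ∧ par b = idx v ∧ G.freeCount par cov b % (d + 1) = d}) ?_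
  intro v f g hfg
  refine congrArg card (filter_congr fun b _ => and_congr_right fun _ =>
    and_congr_right fun hb => ?_)
  rw [freeCount, freeCount]
  suffices h : (G.siblings par b).filter (fun w => f w = 0) =
      (G.siblings par b).filter fun w => g w = 0 by rw [h]
  refine filter_congr fun w hw => ?_
  rw [hfg w]
  have h1 := h.par_lt w
  rw [(mem_siblings.1 hw).1, hb] at h1
  have := hN w
  omega

/-- The number of the clique containing `v` among the cliques that meet the block of `v` and its
parent. The clique of the parent has number `0`; the free vertices are divided into cliques in
the order of their positions, filling up the clique of the parent first if it lies in the block,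
and the cliques of the covered vertices come last. -/
noncomputable def groupIndex (G : SimpleGraph V) (d : ℕ) (idx par cov : V → ℕ) (v : V) : ℕ :=
  if cov v = 0 then
    (#{w ∈ {w ∈ G.siblings par v | cov w = 0} | idx w < idx v} +
      if G.freeCount par cov v % (d + 1) = d then 1 else d + 1) / (d + 1)
  else
    G.freeCount par cov v / (d + 1) + 1 +
      #{w ∈ {w ∈ G.siblings par v | cov w ≠ 0} | idx w < idx v}

theorem freeCount_congr {v w : V} (hvw : G.siblings par w = G.siblings par v) :
    G.freeCount par cov w = G.freeCount par cov v := by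
  rw [freeCount, freeCount, hvw]

namespace IsFeasible

theorem freeCount_mod (hf : G.IsFeasible k d idx par cov) (h : G.IsSearchOrder idx par)
    (hG : G.IsBlockGraph) {v : V} (hv : par v ≠ 0) :
    G.freeCount par cov v % (d + 1) = 0 ∨ G.freeCount par cov v % (d + 1) = d := by
  obtain ⟨b, hb, hbh⟩ := h.exists_isHead hG hv
  rw [← freeCount_congr (h.siblings_eq hG hb)]
  exact hf.mod b hbh

theorem counts_lt (hf : G.IsFeasible k d idx par cov) (h : G.IsSearchOrder idx par)
    (hG : G.IsBlockGraph) {v : V} (hv : par v ≠ 0) :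
    G.coveredCount par cov v + G.freeCount par cov v / (d + 1) < k := by
  obtain ⟨b, hb, hbh⟩ := h.exists_isHead hG hv
  rw [← freeCount_congr (h.siblings_eq hG hb), coveredCount, ← h.siblings_eq hG hb]
  exact hf.lt b hbh

/-- Adding the shift of the ranks used in `groupIndex` turns the number of free vertices into a
multiple of `d + 1`. -/
theorem freeCount_add (hf : G.IsFeasible k d idx par cov) (h : G.IsSearchOrder idx par)
    (hG : G.IsBlockGraph) {v : V} (hv : par v ≠ 0) :
    G.freeCount par cov v + (if G.freeCount par cov v % (d + 1) = d then 1 else d + 1) =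
      (G.freeCount par cov v / (d + 1) + 1) * (d + 1) := by
  have h1 := Nat.div_add_mod' (G.freeCount par cov v) (d + 1)
  have h2 := hf.freeCount_mod h hG hv
  rw [add_mul]
  split_ifs <;> omega

theorem groupIndex_le (hf : G.IsFeasible k d idx par cov) (h : G.IsSearchOrder idx par)
    (hG : G.IsBlockGraph) {v : V} (hv : par v ≠ 0) (h0 : cov v = 0) :
    G.groupIndex d idx par cov v ≤ G.freeCount par cov v / (d + 1) := by
  rw [groupIndex, if_pos h0, ← Nat.lt_succ_iff, Nat.div_lt_iff_lt_mul (by omega)]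
  rw [Nat.succ_eq_add_one, ← hf.freeCount_add h hG hv, Nat.add_lt_add_iff_right]
  exact card_lt_card (filter_ssubset.2 ⟨v, mem_filter.2 ⟨self_mem_siblings v, h0⟩, lt_irrefl _⟩)

theorem groupIndex_lt (hf : G.IsFeasible k d idx par cov) (h : G.IsSearchOrder idx par)
    (hG : G.IsBlockGraph) {v : V} (hv : par v ≠ 0) : G.groupIndex d idx par cov v < k := by
  have h1 := hf.counts_lt h hG hv
  by_cases h0 : cov v = 0
  · have := hf.groupIndex_le h hG hv h0
    omega
  · have : #{w ∈ {w ∈ G.siblings par v | cov w ≠ 0} | idx w < idx v} <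
        G.coveredCount par cov v :=
      card_lt_card (filter_ssubset.2 ⟨v, mem_filter.2 ⟨self_mem_siblings v, h0⟩, lt_irrefl _⟩)
    rw [groupIndex, if_neg h0]
    omega

theorem eq_of_groupIndex_eq (hf : G.IsFeasible k d idx par cov) (h : G.IsSearchOrder idx par)
    (hG : G.IsBlockGraph) {v w : V} (hv : par v ≠ 0) (h0 : cov v ≠ 0)
    (hw : w ∈ G.siblings par v)
    (hvw : G.groupIndex d idx par cov w = G.groupIndex d idx par cov v) : w = v := by
  have hS := h.siblings_eq hG hw
  have hpw : par w ≠ 0 := by rwa [(mem_siblings.1 hw).1]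
  by_cases hw0 : cov w = 0
  · have := hf.groupIndex_le h hG hpw hw0
    rw [hvw, groupIndex, if_neg h0, freeCount_congr hS] at this
    omega
  rw [groupIndex, groupIndex, if_neg hw0, if_neg h0, freeCount_congr hS, hS,
    Nat.add_left_cancel_iff] at hvw
  have hone := card_filter_rank h.injective {x ∈ G.siblings par v | cov x ≠ 0}
    (fun r => r = #{x ∈ {x ∈ G.siblings par v | cov x ≠ 0} | idx x < idx v})
  have hle : #{r ∈ range #{x ∈ G.siblings par v | cov x ≠ 0} |
      r = #{x ∈ {x ∈ G.siblings par v | cov x ≠ 0} | idx x < idx v}} ≤ 1 := by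
    rw [card_le_one]
    intro a ha b hb
    exact (mem_filter.1 ha).2.trans (mem_filter.1 hb).2.symm
  rw [← hone, card_le_one] at hle
  exact hle w (mem_filter.2 ⟨mem_filter.2 ⟨hw, hw0⟩, hvw⟩) v
    (mem_filter.2 ⟨mem_filter.2 ⟨self_mem_siblings v, h0⟩, rfl⟩)

/-- The cliques that consist of free vertices have `d + 1` members; clique `0` contains `d` free
vertices if the block covers the parent, and none otherwise. -/
theorem card_groupIndex_eq (hf : G.IsFeasible k d idx par cov) (h : G.IsSearchOrder idx par)
    (hG : G.IsBlockGraph) {v : V} (hv : par v ≠ 0) {q : ℕ}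
    (hq : q ≤ G.freeCount par cov v / (d + 1)) :
    #{w ∈ G.siblings par v | G.groupIndex d idx par cov w = q} =
      if q = 0 then if G.freeCount par cov v % (d + 1) = d then d else 0 else d + 1 := by
  have hS : (G.siblings par v).filter (fun w => G.groupIndex d idx par cov w = q) =
      ((G.siblings par v).filter fun w => cov w = 0).filter fun w =>
        (#{x ∈ {x ∈ G.siblings par v | cov x = 0} | idx x < idx w} +
          if G.freeCount par cov v % (d + 1) = d then 1 else d + 1) / (d + 1) = q := by
    rw [filter_filter]
    refine filter_congr fun w hw => ?_
    have hS := h.siblings_eq hG hw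
    by_cases h0 : cov w = 0
    · rw [groupIndex, if_pos h0, hS, freeCount_congr hS]
      exact (and_iff_right h0).symm
    · rw [groupIndex, if_neg h0, freeCount_congr hS]
      refine iff_of_false (fun h1 => ?_) (fun h1 => h0 h1.1)
      omega
  rw [hS, card_filter_rank h.injective _ (fun r =>
    (r + if G.freeCount par cov v % (d + 1) = d then 1 else d + 1) / (d + 1) = q),
    card_filter_add_div_eq]
  · split_ifs <;> omega
  · split_ifs <;> omega
  · rw [← freeCount, hf.freeCount_add h hG hv]
    exact Nat.mul_le_mul_right _ (by omega)

/-- If the criterion holds, coloring each block by cyclic shifts of the clique numbers that give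
the color of the parent to number `0` is an exact coloring. -/
theorem exists_isExactColoring (hf : G.IsFeasible k d idx par cov) (h : G.IsSearchOrder idx par)
    (hG : G.IsBlockGraph) (hk : 0 < k) (hd : 0 < d) (hcov : G.IsCoverCount d idx par cov) :
    ∃ c : V → Fin k, G.IsExactColoring d c := by
  classical
  obtain ⟨c, hc⟩ := exists_eq_of_forall_lt idx
    (fun v f => if hv : ∃ p, idx p = par v then (f hv.choose + G.groupIndex d idx par cov v) % k
      else 0) (by
    intro v f g hfg
    split_ifs with hv
    · rw [hfg]
      rw [hv.choose_spec]
      exact h.par_lt v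
    · rfl)
  have hck : ∀ v, c v < k := by
    intro v
    rw [hc v]
    split_ifs
    · exact Nat.mod_lt _ hk
    · exact hk
  have hcp : ∀ p v, par v = idx p → c v = (c p + G.groupIndex d idx par cov v) % k := by
    intro p v hpv
    have hv : ∃ p, idx p = par v := ⟨p, hpv.symm⟩
    rw [hc v, dif_pos hv, h.injective (hv.choose_spec.trans hpv)]
  have hpos := h.pos
  -- A child has the color of its parent exactly if its clique number is `0`.
  have hparent : ∀ p v, par v = idx p → (c v = c p ↔ G.groupIndex d idx par cov v = 0) := by
    intro p v hpv
    have hlt := hf.groupIndex_lt h hG (v := v) (hpv ▸ (hpos p).ne')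
    rw [hcp p v hpv]
    nth_rewrite 2 [← Nat.mod_eq_of_lt (hck p)]
    constructor
    · intro h1
      have h2 : c p + G.groupIndex d idx par cov v ≡ c p + 0 [MOD k] := h1
      exact Nat.ModEq.eq_of_lt_of_lt (Nat.ModEq.add_left_cancel' _ h2) hlt hk
    · intro h1
      rw [h1, add_zero]
  have hsib : ∀ v w, par v ≠ 0 → par w = par v →
      (c w = c v ↔ G.groupIndex d idx par cov w = G.groupIndex d idx par cov v) := by
    intro v w hv hwv
    obtain ⟨p, hp, -, -⟩ := h.exists_parent v hv
    rw [hcp p v hp.symm, hcp p w (hwv.trans hp.symm)]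
    constructor
    · intro h1
      exact Nat.ModEq.eq_of_lt_of_lt (Nat.ModEq.add_left_cancel' (c p) h1)
        (hf.groupIndex_lt h hG (hwv ▸ hv)) (hf.groupIndex_lt h hG hv)
    · intro h1
      rw [h1]
  refine ⟨fun v => ⟨c v, hck v⟩, isExactColoring_iff_card_eq.2 fun v => ?_⟩
  simp only [Fin.mk.injEq]
  rw [← card_filter_add_card_filter_not (fun w => par w = idx v), filter_filter, filter_filter]
  by_cases h0 : cov v = 0
  · have hv : par v ≠ 0 := fun hv => hf.root v hv h0
    obtain ⟨p, hp, hpv, hplt⟩ := h.exists_parent v hv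
    have hdown : (univ.filter fun w => (G.Adj v w ∧ c w = c v) ∧ par w = idx v) = ∅ := by
      rw [filter_eq_empty_iff]
      rintro w - ⟨⟨-, hw⟩, hpw⟩
      rw [hparent v w hpw] at hw
      have hpw0 : par w ≠ 0 := hpw ▸ (hpos v).ne'
      have hcard := hf.card_groupIndex_eq h hG hpw0 (Nat.zero_le _)
      have hcard' : 0 < #{x ∈ G.siblings par w | G.groupIndex d idx par cov x = 0} :=
        card_pos.2 ⟨w, mem_filter.2 ⟨self_mem_siblings w, hw⟩⟩
      rw [hcard, if_pos rfl] at hcard'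
      obtain ⟨b, hb, hbh⟩ := h.exists_isHead hG hpw0
      rw [hcov v, card_eq_zero, filter_eq_empty_iff] at h0
      refine h0 (mem_univ b) ⟨hbh, (mem_siblings.1 hb).1.trans hpw, ?_⟩
      rw [freeCount_congr (h.siblings_eq hG hb)]
      by_contra hne
      simp [hne] at hcard'
    have hcard := hf.card_groupIndex_eq h hG hv (hf.groupIndex_le h hG hv h0)
    have hmem : v ∈ (G.siblings par v).filter fun w =>
        G.groupIndex d idx par cov w = G.groupIndex d idx par cov v :=
      mem_filter.2 ⟨self_mem_siblings v, rfl⟩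
    have hpn : p ∉ (G.siblings par v) := by
      intro hps
      have := h.par_lt p
      rw [(mem_siblings.1 hps).1] at this
      omega
    have hup : (univ.filter fun w => (G.Adj v w ∧ c w = c v) ∧ ¬ par w = idx v) =
        if G.groupIndex d idx par cov v = 0 then
          insert p (((G.siblings par v).filter fun w =>
            G.groupIndex d idx par cov w = G.groupIndex d idx par cov v).erase v)
        else ((G.siblings par v).filter fun w =>
            G.groupIndex d idx par cov w = G.groupIndex d idx par cov v).erase v := by
      have hmem : ∀ w, ((G.Adj v w ∧ c w = c v) ∧ ¬ par w = idx v) ↔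
          (w = p ∧ G.groupIndex d idx par cov v = 0) ∨ w ≠ v ∧ w ∈ G.siblings par v ∧
            G.groupIndex d idx par cov w = G.groupIndex d idx par cov v := by
        intro w
        constructor
        · rintro ⟨⟨hw, cw⟩, hpw⟩
          rcases h.adj_cases hG hw with h1 | h1 | ⟨h1, -, h2⟩
          · exact absurd h1 hpw
          · left
            exact ⟨h.injective (h1.symm.trans hp.symm), (hparent w v h1).1 cw.symm⟩
          · right
            exact ⟨hw.ne', h2, (hsib v w hv h1).1 cw⟩
        · rintro (⟨rfl, hg⟩ | ⟨hne, hw, hg⟩)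
          · refine ⟨⟨hpv.symm, ((hparent w v hp.symm).2 hg).symm⟩, fun h1 => ?_⟩
            have := h.par_lt w
            omega
          · have hw' := mem_siblings.1 hw
            refine ⟨⟨hw'.2.resolve_left hne, (hsib v w hv hw'.1).2 hg⟩, fun h1 => ?_⟩
            have := h.par_lt v
            omega
      ext w
      rw [mem_filter, hmem w]
      split_ifs with hg
      · simp only [mem_insert, mem_erase, mem_filter, mem_univ, true_and, hg, and_true]
      · simp only [mem_erase, mem_filter, mem_univ, true_and, hg, and_false, false_or]
    rw [hdown, hup, card_empty, zero_add]
    split_ifs with hg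
    · rw [card_insert_of_notMem (by simp [hpn]), card_erase_of_mem hmem, hcard, if_pos hg]
      have hpos' := card_pos.2 ⟨v, hmem⟩
      rw [hcard, if_pos hg] at hpos'
      split_ifs at hpos' ⊢ <;> omega
    · rw [card_erase_of_mem hmem, hcard, if_neg hg]
      rfl
  · have hup : (univ.filter fun w => (G.Adj v w ∧ c w = c v) ∧ ¬ par w = idx v) = ∅ := by
      rw [filter_eq_empty_iff]
      rintro w - ⟨⟨hw, cw⟩, hpw⟩
      rcases h.adj_cases hG hw with h1 | h1 | ⟨h1, h2, h3⟩
      · exact hpw h1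
      · have := (hparent w v h1).1 cw.symm
        rw [groupIndex, if_neg h0] at this
        simp at this
      · exact hw.ne' (hf.eq_of_groupIndex_eq h hG h2 h0 h3 ((hsib v w h2 h1).1 cw))
    have hone : cov v = 1 := le_antisymm (hf.le_one v) (Nat.pos_of_ne_zero h0)
    rw [hcov v, card_eq_one] at hone
    obtain ⟨b, hb⟩ := hone
    have hbm : b ∈ (univ.filter fun b => G.IsHead idx par b ∧ par b = idx v ∧
        G.freeCount par cov b % (d + 1) = d) := by
      rw [hb]
      exact mem_singleton_self b
    obtain ⟨-, hbh, hpb, hbd⟩ := mem_filter.1 hbm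
    have hdown : (univ.filter fun w => (G.Adj v w ∧ c w = c v) ∧ par w = idx v) =
        (G.siblings par b).filter fun w => G.groupIndex d idx par cov w = 0 := by
      ext w
      simp only [mem_filter, mem_univ, true_and]
      constructor
      · rintro ⟨⟨-, cw⟩, hpw⟩
        have hg := (hparent v w hpw).1 cw
        refine ⟨?_, hg⟩
        have hpw0 : par w ≠ 0 := hpw ▸ (hpos v).ne'
        have hcard := hf.card_groupIndex_eq h hG hpw0 (Nat.zero_le _)
        have hcard' : 0 < #{x ∈ G.siblings par w | G.groupIndex d idx par cov x = 0} :=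
          card_pos.2 ⟨w, mem_filter.2 ⟨self_mem_siblings w, hg⟩⟩
        rw [hcard, if_pos rfl] at hcard'
        obtain ⟨b', hb', hbh'⟩ := h.exists_isHead hG hpw0
        have hbb : b' ∈ ({b} : Finset V) := by
          rw [← hb, mem_filter]
          refine ⟨mem_univ b', hbh', (mem_siblings.1 hb').1.trans hpw, ?_⟩
          rw [freeCount_congr (h.siblings_eq hG hb')]
          by_contra hne
          simp [hne] at hcard'
        rw [← mem_singleton.1 hbb, h.siblings_eq hG hb']
        exact self_mem_siblings w
      · rintro ⟨hw, hg⟩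
        have hpw := (mem_siblings.1 hw).1.trans hpb
        exact ⟨⟨h.adj_of_par_eq hpw, (hparent v w hpw).2 hg⟩, hpw⟩
    rw [hdown, hup, hf.card_groupIndex_eq h hG hbh.1 (Nat.zero_le _), if_pos rfl, if_pos hbd]
    rfl

end IsFeasible

/-- On a block graph, the numbers computed along a search order decide exact colorability. -/
theorem IsSearchOrder.exactChromaticNumber_le_iff_isFeasible (h : G.IsSearchOrder idx par)
    (hG : G.IsBlockGraph) (hk : 0 < k) (hd : 0 < d) (hcov : G.IsCoverCount d idx par cov) :
    G.exactChromaticNumber d ≤ (k : ℕ∞) ↔ G.IsFeasible k d idx par cov := by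
  rw [exactChromaticNumber_le_iff]
  exact ⟨fun ⟨_, hc⟩ => h.isFeasible_of_isExactColoring hG hd hcov hc,
    fun hf => hf.exists_isExactColoring h hG hk hd hcov⟩

end SimpleGraph

/-! ### A program logic with running times -/

namespace RAM

/-- A terminating run is not affected by program parts further down the stack. -/
theorem run_append {W : ℕ} {s u : ℕ} {L : List Prog} {σ τ : Store}
    (h : run W s ⟨L, σ⟩ = some ⟨[], τ⟩) (K : List Prog) :
    run W (s + u) ⟨L ++ K, σ⟩ = run W u ⟨K, τ⟩ := by
  induction s generalizing L σ with
  | zero =>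
    simp only [run, Option.some.injEq, Config.mk.injEq] at h
    obtain ⟨rfl, rfl⟩ := h
    simp
  | succ s ih =>
    rw [Nat.add_right_comm]
    simp only [run] at h ⊢
    cases L with
    | nil => simp [step] at h
    | cons p L =>
      have hstep : step W ⟨p :: L ++ K, σ⟩ =
          (step W ⟨p :: L, σ⟩).map fun c => ⟨c.todo ++ K, c.store⟩ := by
        cases p <;> simp only [List.cons_append, step, writeReg, writeArr] <;>
          (try split_ifs) <;> simp
      rw [hstep]
      cases hc : step W ⟨p :: L, σ⟩ with
      | none => simp [hc] at h
      | some c =>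
        rw [hc] at h
        exact ih h

@[simp]
theorem Store.reg_setReg (σ : Store) (x v y : ℕ) :
    (σ.setReg x v).reg y = if y = x then v else σ.reg y := by
  simp [Store.setReg, Function.update_apply]

@[simp]
theorem Store.arr_setReg (σ : Store) (x v : ℕ) : (σ.setReg x v).arr = σ.arr := rfl

@[simp]
theorem Store.reg_setArr (σ : Store) (a i v : ℕ) : (σ.setArr a i v).reg = σ.reg := rfl

@[simp]
theorem Store.arr_setArr (σ : Store) (a i v b : ℕ) :
    (σ.setArr a i v).arr b = if b = a then Function.update (σ.arr a) i v else σ.arr b := by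
  by_cases h : b = a <;> simp [Store.setArr, h]

/-- The weakest precondition of `p` for the postcondition `Q`. The predicates speak of a store and
of the number of steps made so far. -/
def wp (W : ℕ) : Prog → (Store → ℕ → Prop) → Store → ℕ → Prop
  | .skip, Q, σ, t => Q σ (t + 1)
  | .const x m, Q, σ, t => m ≤ W ∧ Q (σ.setReg x m) (t + 1)
  | .copy x y, Q, σ, t => σ.reg y ≤ W ∧ Q (σ.setReg x (σ.reg y)) (t + 1)
  | .add x y z, Q, σ, t =>
    σ.reg y + σ.reg z ≤ W ∧ Q (σ.setReg x (σ.reg y + σ.reg z)) (t + 1)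
  | .sub x y z, Q, σ, t =>
    σ.reg y - σ.reg z ≤ W ∧ Q (σ.setReg x (σ.reg y - σ.reg z)) (t + 1)
  | .load x a y, Q, σ, t =>
    σ.arr a (σ.reg y) ≤ W ∧ Q (σ.setReg x (σ.arr a (σ.reg y))) (t + 1)
  | .store a x y, Q, σ, t =>
    (σ.reg x ≤ W ∧ σ.reg y ≤ W) ∧ Q (σ.setArr a (σ.reg x) (σ.reg y)) (t + 1)
  | .seq p q, Q, σ, t => wp W p (fun σ t => wp W q Q σ t) σ (t + 1)
  | .ite b p q, Q, σ, t =>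
    (b.eval σ = true → wp W p Q σ (t + 1)) ∧ (b.eval σ = false → wp W q Q σ (t + 1))
  | .while b p, Q, σ, t => ∃ s τ, Computes W (.while b p) σ s τ ∧ Q τ (t + s)

section

variable {W : ℕ} {Q : Store → ℕ → Prop} {σ : Store} {t : ℕ}

theorem wp_skip : wp W .skip Q σ t ↔ Q σ (t + 1) := Iff.rfl

theorem wp_const {x m : ℕ} :
    wp W (.const x m) Q σ t ↔ m ≤ W ∧ Q (σ.setReg x m) (t + 1) := Iff.rfl

theorem wp_sub {x y z : ℕ} : wp W (.sub x y z) Q σ t ↔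
    σ.reg y - σ.reg z ≤ W ∧ Q (σ.setReg x (σ.reg y - σ.reg z)) (t + 1) := Iff.rfl

theorem wp_load {x a y : ℕ} : wp W (.load x a y) Q σ t ↔
    σ.arr a (σ.reg y) ≤ W ∧ Q (σ.setReg x (σ.arr a (σ.reg y))) (t + 1) := Iff.rfl

theorem wp_seq {p q : Prog} :
    wp W (.seq p q) Q σ t ↔ wp W p (fun σ t => wp W q Q σ t) σ (t + 1) := Iff.rfl

theorem wp_ite {b : Test} {p q : Prog} : wp W (.ite b p q) Q σ t ↔
    (b.eval σ = true → wp W p Q σ (t + 1)) ∧ (b.eval σ = false → wp W q Q σ (t + 1)) := Iff.rfl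

end

theorem exists_computes_of_wp {W : ℕ} {p : Prog} {Q : Store → ℕ → Prop} {σ : Store} {t : ℕ}
    (h : wp W p Q σ t) : ∃ s τ, Computes W p σ s τ ∧ Q τ (t + s) := by
  induction p generalizing Q σ t with
  | skip => exact ⟨1, σ, rfl, h⟩
  | const x m => exact ⟨1, _, by simp [Computes, run, step, writeReg, h.1], h.2⟩
  | copy x y => exact ⟨1, _, by simp [Computes, run, step, writeReg, h.1], h.2⟩
  | add x y z => exact ⟨1, _, by simp [Computes, run, step, writeReg, h.1], h.2⟩
  | sub x y z =>
    exact ⟨1, _, by simp only [Computes, run, step, writeReg, if_pos h.1]; rfl, h.2⟩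
  | load x a y => exact ⟨1, _, by simp [Computes, run, step, writeReg, h.1], h.2⟩
  | store a x y => exact ⟨1, _, by simp [Computes, run, step, writeArr, h.1], h.2⟩
  | seq p q ihp ihq =>
    obtain ⟨s, τ, hs, h1⟩ := ihp h
    obtain ⟨u, υ, hu, h2⟩ := ihq h1
    refine ⟨s + u + 1, υ, ?_, ?_⟩
    · exact (run_append hs [q]).trans hu
    · convert h2 using 1
      omega
  | ite b p q ihp ihq =>
    cases hb : b.eval σ with
    | true =>
      obtain ⟨s, τ, hs, h1⟩ := ihp (h.1 hb)
      refine ⟨s + 1, τ, ?_, ?_⟩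
      · simpa [Computes, run, step, hb] using hs
      · convert h1 using 1
        omega
    | false =>
      obtain ⟨s, τ, hs, h1⟩ := ihq (h.2 hb)
      refine ⟨s + 1, τ, ?_, ?_⟩
      · simpa [Computes, run, step, hb] using hs
      · convert h1 using 1
        omega
  | _ => exact h

theorem wp_mono {W : ℕ} {p : Prog} {Q Q' : Store → ℕ → Prop} (hQ : ∀ σ t, Q σ t → Q' σ t)
    {σ : Store} {t : ℕ} (h : wp W p Q σ t) : wp W p Q' σ t := by
  induction p generalizing Q Q' σ t with
  | skip => exact hQ _ _ h
  | const x m => exact ⟨h.1, hQ _ _ h.2⟩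
  | copy x y => exact ⟨h.1, hQ _ _ h.2⟩
  | add x y z => exact ⟨h.1, hQ _ _ h.2⟩
  | sub x y z => exact ⟨h.1, hQ _ _ h.2⟩
  | load x a y => exact ⟨h.1, hQ _ _ h.2⟩
  | store a x y => exact ⟨h.1, hQ _ _ h.2⟩
  | seq p q ihp ihq => exact ihp (fun _ _ => ihq hQ) h
  | ite b p q ihp ihq => exact ⟨fun hb => ihp hQ (h.1 hb), fun hb => ihq hQ (h.2 hb)⟩
  | _ =>
    obtain ⟨s, τ, hs, h1⟩ := h
    exact ⟨s, τ, hs, hQ _ _ h1⟩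

/-- The rule for loops with an invariant `I` that carries a decreasing measure. -/
theorem wp_while {W : ℕ} {b : Test} {p : Prog} {Q : Store → ℕ → Prop}
    (I : ℕ → Store → ℕ → Prop)
    (hI : ∀ m σ t, I m σ t →
      (b.eval σ = true → wp W p (fun σ' t' => ∃ m' < m, I m' σ' t') σ (t + 1)) ∧
      (b.eval σ = false → Q σ (t + 1)))
    {m : ℕ} {σ : Store} {t : ℕ} (h : I m σ t) : wp W (.while b p) Q σ t := by
  induction m using Nat.strong_induction_on generalizing σ t with
  | _ m ih =>
  cases hb : b.eval σ with
  | false =>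
    exact ⟨1, σ, by simp [Computes, run, step, hb], (hI m σ t h).2 hb⟩
  | true =>
    obtain ⟨s, τ, hs, m', hm', h1⟩ := exists_computes_of_wp ((hI m σ t h).1 hb)
    obtain ⟨u, υ, hu, h2⟩ := ih m' hm' h1
    refine ⟨s + u + 1, υ, ?_, ?_⟩
    · simp only [Computes, run, step, hb, if_true, Option.bind_some]
      exact (run_append hs [.while b p]).trans hu
    · convert h2 using 1
      omega

/-! ### Scanning adjacency lists -/

/-- The arrays `offset` and `target` of the input store present the lists `N v`, `v < n`. -/
structure IsListing (n : ℕ) (N : ℕ → List ℕ) (offset target : ℕ → ℕ) : Prop where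
  offset_succ : ∀ v < n, offset (v + 1) = offset v + (N v).length
  target_eq : ∀ v < n, ∀ a (ha : a < (N v).length), target (offset v + a) = (N v)[a]
  offset_le : ∀ v ≤ n, offset v ≤ offset n
  mem_lt : ∀ v w, w ∈ N v → w < n

/-- The adjacency lists `nbr` with vertices regarded as numbers. -/
def neighborList {n : ℕ} (nbr : Fin n → List (Fin n)) (v : ℕ) : List ℕ :=
  if h : v < n then (nbr ⟨v, h⟩).map Fin.val else []

theorem mem_neighborList {n : ℕ} {nbr : Fin n → List (Fin n)} {v w : ℕ} :
    w ∈ neighborList nbr v ↔ ∃ (hv : v < n) (hw : w < n), ⟨w, hw⟩ ∈ nbr ⟨v, hv⟩ := by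
  rw [neighborList]
  split_ifs with hv
  · rw [List.mem_map]
    constructor
    · rintro ⟨x, hx, rfl⟩
      exact ⟨hv, x.2, hx⟩
    · rintro ⟨_, hw, hmem⟩
      exact ⟨_, hmem, rfl⟩
  · simp [hv]

theorem getD_flatten {α : Type*} (L : List (List α)) (v : ℕ) (hv : v < L.length) (a : ℕ)
    (ha : a < L[v].length) (x : α) :
    L.flatten.getD (((L.take v).map List.length).sum + a) x = L[v][a] := by
  have h : L.flatten = (L.take v).flatten ++ (L[v] ++ (L.drop (v + 1)).flatten) := by
    conv_lhs => rw [← List.take_append_drop v L, List.drop_eq_getElem_cons hv,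
      List.flatten_append, List.flatten_cons]
  rw [h, ← List.length_flatten, List.getD_append_right _ _ _ _ (Nat.le_add_right _ _),
    Nat.add_sub_cancel_left, List.getD_append _ _ _ _ ha, List.getD_eq_getElem _ _ ha]

theorem isListing_inputStore {n : ℕ} (nbr : Fin n → List (Fin n)) :
    IsListing n (neighborList nbr) ((inputStore nbr).arr 0) ((inputStore nbr).arr 1) := by
  have hlen : (List.ofFn nbr).length = n := List.length_ofFn
  have hsum : ∀ i ≤ n, (inputStore nbr).arr 0 i =
      (((List.ofFn nbr).take i).map List.length).sum := fun i hi => by simp [inputStore, hi]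
  constructor
  · intro v hv
    rw [hsum _ hv, hsum _ hv.le, List.take_succ_eq_append_getElem (by omega)]
    simp [neighborList, hv]
  · intro v hv a ha
    rw [hsum _ hv.le]
    have h1 := getD_flatten ((List.ofFn nbr).map (List.map Fin.val)) v (by simpa using hv) a
      (by simpa [neighborList, hv] using ha) 0
    rw [← List.map_take, List.map_map] at h1
    have h2 : (List.length ∘ List.map Fin.val : List (Fin n) → ℕ) = List.length := by
      funext l
      simp
    rw [h2] at h1
    simp only [inputStore, one_ne_zero, if_false, if_true, List.map_flatten]
    rw [h1]
    simp [neighborList, hv]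
  · intro v hv
    rw [hsum _ hv, hsum _ le_rfl]
    refine List.Sublist.sum_le_sum ((List.take_sublist_take_left hv).map _) ?_
    simp
  · intro v w hw
    obtain ⟨-, hw, -⟩ := mem_neighborList.1 hw
    exact hw

/-- Run `body` for every neighbour of the vertex in register `9`, with the neighbour in
register `7`; register `1` holds the number `1`. -/
def scan (body : Prog) : Prog :=
  .seq (.load 5 0 9) <| .seq (.add 6 9 1) <| .seq (.load 6 0 6) <|
  .while (.lt 5 6) <| .seq (.load 7 1 5) <| .seq body <| .add 5 5 1

/-- The registers and arrays on which the scan of the list of `v` relies, before its entry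
number `a` is read. -/
structure ScanFrame (offset target : ℕ → ℕ) (v a : ℕ) (σ : Store) : Prop where
  reg1 : σ.reg 1 = 1
  reg5 : σ.reg 5 = offset v + a
  reg6 : σ.reg 6 = offset (v + 1)
  arr0 : σ.arr 0 = offset
  arr1 : σ.arr 1 = target

theorem wp_scan {W n : ℕ} {N : ℕ → List ℕ} {offset target : ℕ → ℕ}
    (hL : IsListing n N offset target) (hW : offset n + n ≤ W) {body : Prog}
    {Q : Store → ℕ → Prop} {v : ℕ} (hv : v < n) (I : ℕ → Store → ℕ → Prop) {σ : Store} {t : ℕ}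
    (h1 : σ.reg 1 = 1) (h9 : σ.reg 9 = v) (h0 : σ.arr 0 = offset) (ha1 : σ.arr 1 = target)
    (hinit : I 0 (((σ.setReg 5 (offset v)).setReg 6 (v + 1)).setReg 6 (offset (v + 1))) (t + 6))
    (hstep : ∀ a (ha : a < (N v).length) σ t, I a σ t → ScanFrame offset target v a σ →
      wp W body (fun σ' t' => ScanFrame offset target v a σ' ∧
        I (a + 1) (σ'.setReg 5 (offset v + a + 1)) (t' + 1)) (σ.setReg 7 (N v)[a]) (t + 4))
    (hpost : ∀ σ t, I (N v).length σ t → ScanFrame offset target v (N v).length σ → Q σ (t + 1)) :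
    wp W (scan body) Q σ t := by
  have hs := hL.offset_succ v hv
  have hle := hL.offset_le (v + 1) hv
  simp only [scan, wp, Store.reg_setReg, Store.arr_setReg, Nat.reduceEqDiff, if_true, if_false,
    h1, h9, h0, OfNat.one_ne_ofNat]
  refine ⟨by omega, by omega, by omega, ?_⟩
  refine wp_while (fun m σ t => ∃ a ≤ (N v).length, m = (N v).length - a ∧
    ScanFrame offset target v a σ ∧ I a σ t) ?_ (m := (N v).length) ?_
  · rintro m σ t ⟨a, ha, rfl, hF, hI⟩
    simp only [Test.eval, hF.reg5, hF.reg6, decide_eq_true_eq, decide_eq_false_iff_not]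
    constructor
    · intro hlt
      have ha' : a < (N v).length := by omega
      have htv := hL.target_eq v hv a ha'
      have hmem := hL.mem_lt v _ (List.getElem_mem ha')
      simp only [wp, hF.arr1, hF.reg5, htv]
      refine ⟨by omega, wp_mono ?_ (hstep a ha' σ t hI hF)⟩
      rintro σ' t' ⟨hF', hI'⟩
      rw [hF'.reg5, hF'.reg1]
      refine ⟨by omega, _, ?_, a + 1, ha', rfl, ?_, hI'⟩
      · omega
      · constructor <;> simp [hF'.reg1, hF'.reg6, hF'.arr0, hF'.arr1, add_assoc]
    · intro hlt
      have ha' : a = (N v).length := by omega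
      subst ha'
      exact hpost _ _ hI hF
  · refine ⟨0, Nat.zero_le _, rfl, ?_, hinit⟩
    constructor <;> simp [h1, h0, ha1]

end RAM

/-! ### Breadth-first search -/

namespace RAM

open Finset

/-- The invariant of the search: the first `i` of the `s` vertices in the queue `ord` are
processed. Positions in the queue start at `1`, so that `0` marks unvisited vertices in `idx` and
vertices without a parent in `par`. -/
structure SearchInv (n : ℕ) (N : ℕ → List ℕ) (ord idx par : ℕ → ℕ) (i s : ℕ) : Prop where
  le : i ≤ s
  ord_spec : ∀ p, 1 ≤ p → p ≤ s → ord p < n ∧ idx (ord p) = p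
  idx_spec : ∀ v, idx v ≠ 0 → v < n ∧ idx v ≤ s ∧ ord (idx v) = v
  par_new : ∀ v, idx v = 0 → par v = 0
  par_spec : ∀ v, par v ≠ 0 → par v < idx v ∧ v ∈ N (ord (par v))
  first : ∀ v w, par v ≠ 0 → w ∈ N v → idx w ≠ 0 → par v ≤ idx w
  root : ∀ r v w, idx r ≠ 0 → par r = 0 → w ∈ N v → idx v ≠ 0 → idx v < idx r →
    idx w ≠ 0 ∧ idx w < idx r
  processed : ∀ v w, idx v ≠ 0 → idx v ≤ i → w ∈ N v → idx w ≠ 0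

namespace SearchInv

variable {n : ℕ} {N : ℕ → List ℕ} {ord idx par : ℕ → ℕ} {i s : ℕ}

theorem zero : SearchInv n N (fun _ => 0) (fun _ => 0) (fun _ => 0) 0 0 := by
  constructor <;> intros <;> omega

theorem injOn (h : SearchInv n N ord idx par i s) : Set.InjOn ord (Set.Icc 1 s) := by
  intro p hp q hq hpq
  have h1 := (h.ord_spec p hp.1 hp.2).2
  have h2 := (h.ord_spec q hq.1 hq.2).2
  rw [← h1, ← h2, hpq]

theorem le_card (h : SearchInv n N ord idx par i s) : s ≤ n := by
  have h1 : #(Icc 1 s) ≤ #(range n) := by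
    refine card_le_card_of_injOn ord ?_ (by simpa using h.injOn)
    intro p hp
    rw [coe_Icc] at hp
    simpa using (h.ord_spec p hp.1 hp.2).1
  simpa using h1

theorem lt_card (h : SearchInv n N ord idx par i s) {w : ℕ} (hw : w < n) (h0 : idx w = 0) :
    s < n := by
  have h1 : #(Icc 1 s) ≤ #((range n).erase w) := by
    refine card_le_card_of_injOn ord ?_ (by simpa using h.injOn)
    intro p hp
    rw [coe_Icc] at hp
    have h2 := h.ord_spec p hp.1 hp.2
    have h3 : ord p ≠ w := by
      rintro rfl
      have := hp.1
      omega
    simpa [h3] using h2.1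
  rw [card_erase_of_mem (by simpa using hw), card_range, Nat.card_Icc] at h1
  omega

/-- An unvisited neighbour `w` of the vertex in process enters the queue. No earlier vertex is a
neighbour of `w`, as all neighbours of processed vertices are visited. -/
theorem push_child (h : SearchInv n N ord idx par i s) (hi : i < s)
    (hsymm : ∀ v w, w ∈ N v → v ∈ N w) {w : ℕ} (hw : w < n) (hmem : w ∈ N (ord (i + 1)))
    (h0 : idx w = 0) :
    SearchInv n N (Function.update ord (s + 1) w) (Function.update idx w (s + 1))
      (Function.update par w (i + 1)) i (s + 1) := by
  have hu := h.ord_spec (i + 1) (by omega) hi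
  constructor
  · exact h.le.trans (Nat.le_succ s)
  · intro p h1 h2
    have := h.ord_spec p h1
    grind
  · intro v hv
    have := h.idx_spec v
    grind
  · intro v hv
    have := h.par_new v
    grind
  · intro v hv
    have := h.par_spec v
    have := h.idx_spec v
    grind
  · intro v x hv hx hx0
    have h1 := h.first v x
    have h2 := h.par_spec v
    have h3 := h.idx_spec v
    have h4 := h.processed x v
    have h5 := hsymm v x hx
    grind
  · intro r v x hr hpr hx hv hlt
    have h1 := h.root r v x
    have h2 := h.idx_spec r
    have h3 := h.idx_spec v
    grind
  · intro v x hv hle hx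
    have := h.processed v x
    have := h.le
    grind

/-- When the queue is exhausted, an unvisited vertex enters it as a root. The vertices before it are
closed under adjacency. -/
theorem push_root (h : SearchInv n N ord idx par i i) {w : ℕ} (hw : w < n) (h0 : idx w = 0) :
    SearchInv n N (Function.update ord (i + 1) w) (Function.update idx w (i + 1)) par i
      (i + 1) := by
  have hpw := h.par_new w h0
  constructor
  · exact Nat.le_succ i
  · intro p h1 h2
    have := h.ord_spec p h1
    grind
  · intro v hv
    have := h.idx_spec v
    grind
  · intro v hv
    have := h.par_new v
    grind
  · intro v hv
    have := h.par_spec v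
    have := h.idx_spec v
    grind
  · intro v x hv hx hx0
    have h1 := h.first v x
    have h2 := h.par_spec v
    have h3 := h.idx_spec v
    grind
  · intro r v x hr hpr hx hv hlt
    have h1 := h.root r v x
    have h2 := h.idx_spec r
    have h3 := h.idx_spec v
    have h4 := h.processed v x
    have h5 := h.idx_spec x
    grind
  · intro v x hv hle hx
    have := h.processed v x
    grind

theorem advance (h : SearchInv n N ord idx par i s) (hi : i < s)
    (hN : ∀ w ∈ N (ord (i + 1)), idx w ≠ 0) : SearchInv n N ord idx par (i + 1) s := by
  refine ⟨hi, h.ord_spec, h.idx_spec, h.par_new, h.par_spec, h.first, h.root, ?_⟩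
  intro v w hv hle hw
  rcases Nat.lt_or_ge i (idx v) with hlt | hle'
  · have : idx v = i + 1 := by omega
    have h2 := (h.idx_spec v hv).2.2
    rw [this] at h2
    exact hN w (h2 ▸ hw)
  · exact h.processed v w hv hle' hw

theorem eq_card (h : SearchInv n N ord idx par i s) (hall : ∀ v < n, idx v ≠ 0) : s = n := by
  refine le_antisymm h.le_card ?_
  have h1 : #(range n) ≤ #(Icc 1 s) := by
    refine card_le_card_of_injOn idx ?_ ?_
    · intro v hv
      have hv := hall v (by simpa using hv)
      have := h.idx_spec v hv
      simp only [coe_Icc, Set.mem_Icc]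
      omega
    · intro v hv w hw hvw
      have hv := h.idx_spec v (hall v (by simpa using hv))
      have hw := h.idx_spec w (hall w (by simpa using hw))
      rw [← hv.2.2, ← hw.2.2, hvw]
  simpa using h1

end SearchInv

/-- Process the queue: the registers `3` and `4` hold the length of the queue and the number of
its processed vertices, and the arrays `2`, `3` and `4` hold `ord`, `idx` and `par`. -/
def searchQueue : Prog :=
  .while (.lt 4 3) <| .seq (.add 4 4 1) <| .seq (.load 9 2 4) <| scan <|
    .seq (.load 8 3 7) <| .ite (.eq 8 10)
      (.seq (.add 3 3 1) <| .seq (.store 2 3 7) <| .seq (.store 3 7 3) <| .store 4 7 4)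
      .skip

/-- Go through all vertices, in register `2`, and start a search at each one that has not been
visited. -/
def search : Prog :=
  .while (.lt 2 0) <| .seq (.load 8 3 2) <| .seq
    (.ite (.eq 8 10) (.seq (.add 3 3 1) <| .seq (.store 2 3 2) <| .store 3 2 3) .skip) <|
    .seq searchQueue <| .add 2 2 1

/-- The values of the registers and arrays that the search does not change: the input, the constants
of the program, the provisional answer `ok`, and the array `cov` that counts for every vertex the
evaluated blocks below it that cover it. -/
structure Constants (n : ℕ) (offset target : ℕ → ℕ) (k d ok : ℕ) (cov : ℕ → ℕ) (σ : Store) :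
    Prop where
  reg0 : σ.reg 0 = n
  reg1 : σ.reg 1 = 1
  reg10 : σ.reg 10 = 0
  reg11 : σ.reg 11 = d + 1
  reg12 : σ.reg 12 = d
  reg13 : σ.reg 13 = k
  reg14 : σ.reg 14 = ok
  arr0 : σ.arr 0 = offset
  arr1 : σ.arr 1 = target
  arr5 : σ.arr 5 = cov

theorem Constants.of_eq {n k d ok : ℕ} {offset target cov : ℕ → ℕ} {σ τ : Store}
    (h : Constants n offset target k d ok cov σ)
    (hreg : ∀ x ∈ [0, 1, 10, 11, 12, 13, 14], τ.reg x = σ.reg x)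
    (harr : ∀ a ∈ [0, 1, 5], τ.arr a = σ.arr a) : Constants n offset target k d ok cov τ := by
  simp only [List.forall_mem_cons] at hreg harr
  obtain ⟨h0, h1, h10, h11, h12, h13, h14, -⟩ := hreg
  obtain ⟨a0, a1, a5, -⟩ := harr
  exact ⟨h0.trans h.reg0, h1.trans h.reg1, h10.trans h.reg10, h11.trans h.reg11,
    h12.trans h.reg12, h13.trans h.reg13, h14.trans h.reg14, a0.trans h.arr0, a1.trans h.arr1,
    a5.trans h.arr5⟩

/-- Every processed vertex accounts for a constant number of steps and a constant number for each
entry of its list. -/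
theorem wp_searchQueue {W n k d ok : ℕ} {N : ℕ → List ℕ} {offset target cov : ℕ → ℕ}
    (hL : IsListing n N offset target) (hW : offset n + n ≤ W)
    (hsymm : ∀ v w, w ∈ N v → v ∈ N w) {Q : Store → ℕ → Prop} {σ : Store} {t i s T r : ℕ}
    (hC : Constants n offset target k d ok cov σ) (hr : σ.reg 2 = r) (h3 : σ.reg 3 = s)
    (h4 : σ.reg 4 = i) (hI : SearchInv n N (σ.arr 2) (σ.arr 3) (σ.arr 4) i s)
    (ht : t ≤ T + 20 * i + 20 * ∑ p ∈ range i, (N (σ.arr 2 (p + 1))).length)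
    (hQ : ∀ σ' t' s', Constants n offset target k d ok cov σ' → σ'.reg 2 = r → σ'.reg 3 = s' →
      σ'.reg 4 = s' → SearchInv n N (σ'.arr 2) (σ'.arr 3) (σ'.arr 4) s' s' →
      (∀ v, σ.arr 3 v ≠ 0 → σ'.arr 3 v ≠ 0) →
      t' ≤ T + 20 * s' + 20 * ∑ p ∈ range s', (N (σ'.arr 2 (p + 1))).length + 1 → Q σ' t') :
    wp W searchQueue Q σ t := by
  refine wp_while (fun m σ' t' => ∃ i s, m = n - i ∧ Constants n offset target k d ok cov σ' ∧
    σ'.reg 2 = r ∧ σ'.reg 3 = s ∧ σ'.reg 4 = i ∧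
    SearchInv n N (σ'.arr 2) (σ'.arr 3) (σ'.arr 4) i s ∧ (∀ v, σ.arr 3 v ≠ 0 → σ'.arr 3 v ≠ 0) ∧
    t' ≤ T + 20 * i + 20 * ∑ p ∈ range i, (N (σ'.arr 2 (p + 1))).length) ?_
    ⟨i, s, rfl, hC, hr, h3, h4, hI, fun _ h => h, ht⟩
  clear! i s t
  rintro m σ₁ t ⟨i, s, rfl, hC, h2, h3, h4, hI, hmono, ht⟩
  have hsn := hI.le_card
  have hle := hI.le
  simp only [Test.eval, h3, h4, decide_eq_true_eq, decide_eq_false_iff_not]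
  constructor
  swap
  · intro hlt
    obtain rfl : s = i := by omega
    exact hQ _ _ _ hC h2 h3 h4 hI hmono (by omega)
  intro hlt
  obtain ⟨hu, hiu⟩ := hI.ord_spec (i + 1) (by omega) hlt
  set u := σ₁.arr 2 (i + 1) with hu_def
  simp only [wp, Store.reg_setReg, Store.arr_setReg, if_true, h4, hC.reg1]
  refine ⟨by omega, by omega, ?_⟩
  refine wp_scan hL hW hu (fun a σ' t' => ∃ s', Constants n offset target k d ok cov σ' ∧
    σ'.reg 2 = r ∧ σ'.reg 3 = s' ∧ σ'.reg 4 = i + 1 ∧ i < s' ∧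
    SearchInv n N (σ'.arr 2) (σ'.arr 3) (σ'.arr 4) i s' ∧ (∀ v, σ₁.arr 3 v ≠ 0 → σ'.arr 3 v ≠ 0) ∧
    (∀ p ≤ s, σ'.arr 2 p = σ₁.arr 2 p) ∧ s ≤ s' ∧
    (∀ b < a, ∀ hb : b < (N u).length, σ'.arr 3 (N u)[b] ≠ 0) ∧
    t' ≤ T + 20 * i + 20 * ∑ p ∈ range i, (N (σ₁.arr 2 (p + 1))).length + 11 + 20 * a)
    ?_ ?_ ?_ ?_ ?_ ?_ ?_
  · simp [hC.reg1]
  · simp [hu_def]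
  · simp [hC.arr0]
  · simp [hC.arr1]
  · refine ⟨s, ?_, ?_⟩
    · exact hC.of_eq (by simp) (by simp)
    · simp only [Store.reg_setReg, Store.arr_setReg, Nat.reduceEqDiff, if_true, if_false, h2, h3,
        true_and]
      exact ⟨hlt, hI, fun _ h => h, fun _ _ => trivial, le_rfl, fun b hb => absurd hb (by omega),
        by omega⟩
  · rintro a ha σ' t' ⟨s', hC', h2', h3', h4', hlt', hI', hmono', hord, hss, hdone, ht'⟩ hF
    set w := (N u)[a] with hw_def
    have hwn : w < n := hL.mem_lt u w (List.getElem_mem ha)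
    have huw : w ∈ N (σ'.arr 2 (i + 1)) := by
      rw [hord (i + 1) (by omega)]
      exact List.getElem_mem ha
    have hsn' := hI'.le_card
    have hwle : σ'.arr 3 w ≤ W := by
      by_cases h0 : σ'.arr 3 w = 0
      · omega
      · have := hI'.idx_spec w h0
        omega
    simp only [wp, Test.eval, Store.reg_setReg, Store.arr_setReg, Store.reg_setArr,
      Store.arr_setArr, Nat.reduceEqDiff, if_true, if_false, hC'.reg10, hC'.reg1, h3', h4',
      decide_eq_true_eq, decide_eq_false_iff_not, OfNat.one_ne_ofNat]
    refine ⟨hwle, fun h0 => ?_, fun h0 => ?_⟩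
    · have hsn'' := hI'.lt_card hwn h0
      refine ⟨by omega, by omega, by omega, by omega, ?_, s' + 1, ?_, ?_⟩
      · constructor <;> simp [hF.reg1, hF.reg5, hF.reg6, hF.arr0, hF.arr1]
      · exact hC'.of_eq (by simp) (by simp)
      · simp only [h2', true_and]
        refine ⟨by omega, hI'.push_child hlt' hsymm hwn huw h0, ?_, ?_, by omega, ?_, by omega⟩
        · intro v hv
          rw [Function.update_apply]
          split_ifs
          · omega
          · exact hmono' v hv
        · intro p hp
          rw [Function.update_of_ne (by omega)]
          exact hord p hp
        · intro b hb hb'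
          by_cases hvw : (N u)[b] = w
          · rw [hvw]
            simp
          · rw [Function.update_of_ne hvw]
            refine hdone b ?_ hb'
            rcases Nat.lt_succ_iff_lt_or_eq.1 hb with hb | rfl
            · exact hb
            · exact absurd rfl hvw
    · refine ⟨?_, s', ?_, ?_⟩
      · constructor <;> simp [hF.reg1, hF.reg5, hF.reg6, hF.arr0, hF.arr1]
      · exact hC'.of_eq (by simp) (by simp)
      · simp only [h2', true_and]
        refine ⟨hlt', hI', hmono', hord, hss, ?_, by omega⟩
        intro b hb hb'
        rcases Nat.lt_succ_iff_lt_or_eq.1 hb with hb | rfl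
        · exact hdone b hb hb'
        · exact h0
  · rintro σ' t' ⟨s', hC', h2', h3', h4', hlt', hI', hmono', hord, hss, hdone, ht'⟩ hF
    have hu' : σ'.arr 2 (i + 1) = u := hord (i + 1) (by omega)
    refine ⟨n - (i + 1), by omega, i + 1, s', rfl, hC', h2', h3', h4', ?_, ?_, ?_⟩
    · refine hI'.advance hlt' ?_
      rw [hu']
      intro w hw
      obtain ⟨b, hb, rfl⟩ := List.getElem_of_mem hw
      exact hdone b hb hb
    · exact fun v hv => hmono' v (hmono v hv)
    · rw [sum_range_succ, hu']
      have hsum : ∑ p ∈ range i, (N (σ'.arr 2 (p + 1))).length =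
          ∑ p ∈ range i, (N (σ₁.arr 2 (p + 1))).length := by
        refine sum_congr rfl fun p hp => ?_
        rw [hord (p + 1) (by have := mem_range.1 hp; omega)]
      rw [hsum]
      omega

theorem wp_search {W n k d ok : ℕ} {N : ℕ → List ℕ} {offset target cov : ℕ → ℕ}
    (hL : IsListing n N offset target) (hW : offset n + n ≤ W)
    (hsymm : ∀ v w, w ∈ N v → v ∈ N w) {Q : Store → ℕ → Prop} {σ : Store} {t : ℕ}
    (hC : Constants n offset target k d ok cov σ) (h2 : σ.reg 2 = 0) (h3 : σ.reg 3 = 0)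
    (h4 : σ.reg 4 = 0) (ha2 : σ.arr 2 = fun _ => 0) (ha3 : σ.arr 3 = fun _ => 0)
    (ha4 : σ.arr 4 = fun _ => 0)
    (hQ : ∀ σ' t', Constants n offset target k d ok cov σ' → σ'.reg 4 = n →
      SearchInv n N (σ'.arr 2) (σ'.arr 3) (σ'.arr 4) n n → (∀ v < n, σ'.arr 3 v ≠ 0) →
      t' ≤ t + 40 * n + 20 * ∑ p ∈ range n, (N (σ'.arr 2 (p + 1))).length + 1 → Q σ' t') :
    wp W search Q σ t := by
  refine wp_while (fun m σ' t' => ∃ r i, r ≤ n ∧ m = n - r ∧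
    Constants n offset target k d ok cov σ' ∧ σ'.reg 2 = r ∧ σ'.reg 3 = i ∧ σ'.reg 4 = i ∧
    SearchInv n N (σ'.arr 2) (σ'.arr 3) (σ'.arr 4) i i ∧ (∀ v < r, σ'.arr 3 v ≠ 0) ∧
    t' ≤ t + 20 * r + 20 * i + 20 * ∑ p ∈ range i, (N (σ'.arr 2 (p + 1))).length) ?_
    ⟨0, 0, Nat.zero_le _, rfl, hC, h2, h3, h4, ?_, fun v hv => absurd hv (by omega), by omega⟩
  swap
  · rw [ha2, ha3, ha4]
    exact SearchInv.zero
  rintro m σ' t' ⟨r, i, hr, rfl, hC', h2', h3', h4', hI, hall, ht⟩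
  simp only [Test.eval, h2', hC'.reg0, decide_eq_true_eq, decide_eq_false_iff_not]
  constructor
  swap
  · intro hlt
    obtain rfl : r = n := by omega
    obtain rfl := hI.eq_card hall
    exact hQ _ _ hC' h4' hI hall (by omega)
  intro hlt
  have hin := hI.le_card
  have hrle : σ'.arr 3 r ≤ W := by
    by_cases h0 : σ'.arr 3 r = 0
    · omega
    · have := hI.idx_spec r h0
      omega
  simp only [wp, Test.eval, Store.reg_setReg, Store.arr_setReg, Store.reg_setArr,
    Nat.reduceEqDiff, if_true, if_false, hC'.reg10, hC'.reg1, h2', h3',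
    decide_eq_true_eq, decide_eq_false_iff_not, OfNat.one_ne_ofNat]
  refine ⟨hrle, fun h0 => ?_, fun h0 => ?_⟩
  · have hin' := hI.lt_card hlt h0
    refine ⟨by omega, by omega, by omega, ?_⟩
    refine wp_searchQueue (k := k) (d := d) (ok := ok) (cov := cov) (r := r) (i := i)
      (s := i + 1) (T := t + 20 * r + 15)
      hL hW hsymm ?_ ?_ ?_ ?_ ?_ ?_ ?_
    · exact hC'.of_eq (by simp) (by simp)
    · simp [h2']
    · simp
    · simp [h4']
    · simpa using hI.push_root hlt h0
    · simp only [Store.arr_setReg, Store.arr_setArr,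
        Nat.reduceEqDiff, if_true, if_false]
      have hsum : ∑ p ∈ range i, (N (Function.update (σ'.arr 2) (i + 1) r (p + 1))).length =
          ∑ p ∈ range i, (N (σ'.arr 2 (p + 1))).length := by
        refine sum_congr rfl fun p hp => ?_
        rw [Function.update_of_ne (by have := mem_range.1 hp; omega)]
      rw [hsum]
      omega
    · intro σ₂ t₂ s₂ hC₂ h2₂ h3₂ h4₂ hI₂ hmono ht₂
      rw [h2₂, hC₂.reg1]
      refine ⟨by omega, n - (r + 1), by omega, r + 1, s₂, by omega, rfl, ?_, ?_⟩
      · exact hC₂.of_eq (by simp) (by simp)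
      · simp only [h3₂,
          h4₂, true_and]
        refine ⟨hI₂, fun v hv => hmono v ?_, by omega⟩
        by_cases hvr : v = r
        · simp [hvr]
        · simpa [hvr] using hall v (by omega)
  · refine wp_searchQueue (k := k) (d := d) (ok := ok) (cov := cov) (r := r) (i := i)
      (s := i) (T := t + 20 * r + 15)
      hL hW hsymm ?_ ?_ ?_ ?_ ?_ ?_ ?_
    · exact hC'.of_eq (by simp) (by simp)
    · simp [h2']
    · simp [h3']
    · simp [h4']
    · simpa using hI
    · simp only [Store.arr_setReg]
      omega
    · intro σ₂ t₂ s₂ hC₂ h2₂ h3₂ h4₂ hI₂ hmono ht₂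
      rw [h2₂, hC₂.reg1]
      refine ⟨by omega, n - (r + 1), by omega, r + 1, s₂, by omega, rfl, ?_, ?_⟩
      · exact hC₂.of_eq (by simp) (by simp)
      · simp only [h3₂,
          h4₂, true_and]
        refine ⟨hI₂, fun v hv => hmono v ?_, by omega⟩
        by_cases hvr : v = r
        · simpa [hvr] using h0
        · simpa [hvr] using hall v (by omega)

end RAM

/-! ### Counting free and covered vertices -/

namespace RAM

open Finset

/-- Of the vertices counted so far, `F` are free and `E` are covered, where `f` is the number of
free vertices modulo `d + 1` and `q` is the number of covered vertices plus the number of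
completed groups of `d + 1` free vertices. -/
def Counted (d F E f q : ℕ) : Prop :=
  f ≤ d ∧ ∃ g, F = f + (d + 1) * g ∧ q = E + g

theorem Counted.mod_eq {d F E f q : ℕ} (h : Counted d F E f q) : F % (d + 1) = f := by
  obtain ⟨hf, g, rfl, -⟩ := h
  rw [Nat.add_mul_mod_self_left, Nat.mod_eq_of_lt (by omega)]

theorem Counted.add_div_eq {d F E f q : ℕ} (h : Counted d F E f q) : E + F / (d + 1) = q := by
  obtain ⟨hf, g, rfl, rfl⟩ := h
  rw [Nat.add_mul_div_left _ _ (by omega), Nat.div_eq_of_lt (by omega), zero_add]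

theorem Counted.le {d F E f q : ℕ} (h : Counted d F E f q) : q ≤ E + F := by
  rw [← h.add_div_eq]
  exact Nat.add_le_add_left (Nat.div_le_self _ _) _

/-- Count the vertex in register `x`, with the numbers `f` and `q` in the registers `15`
and `16`. -/
def countVertex (x : ℕ) : Prog :=
  .seq (.load 19 5 x) <| .ite (.eq 19 10)
    (.seq (.add 15 15 1) <| .ite (.eq 15 11) (.seq (.const 15 0) (.add 16 16 1)) .skip)
    (.add 16 16 1)

theorem wp_countVertex {W n k d ok : ℕ} {offset target cov : ℕ → ℕ} {x F E : ℕ}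
    {Q : Store → ℕ → Prop} {σ : Store} {t : ℕ} (hC : Constants n offset target k d ok cov σ)
    (hcov : cov (σ.reg x) ≤ W) (hd : d + 1 ≤ W) (hFE : F + E + 1 ≤ W)
    (hcount : Counted d F E (σ.reg 15) (σ.reg 16))
    (hQ : ∀ σ' t', (∀ y, y ≠ 15 → y ≠ 16 → y ≠ 19 → σ'.reg y = σ.reg y) → σ'.arr = σ.arr →
      Counted d (F + if cov (σ.reg x) = 0 then 1 else 0) (E + if cov (σ.reg x) = 0 then 0 else 1)
        (σ'.reg 15) (σ'.reg 16) → t' ≤ t + 9 → Q σ' t') :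
    wp W (countVertex x) Q σ t := by
  have hq := hcount.le
  obtain ⟨hf, g, hF, hE⟩ := hcount
  simp only [countVertex, wp, Test.eval, Store.reg_setReg, Nat.reduceEqDiff, if_true, if_false,
    hC.reg10, hC.reg1, hC.reg11, hC.arr5, decide_eq_true_eq, decide_eq_false_iff_not,
    OfNat.one_ne_ofNat]
  refine ⟨hcov, fun h0 => ⟨by omega, fun h1 => ⟨by omega, by omega, ?_⟩, fun h1 => ?_⟩,
    fun h0 => ⟨by omega, ?_⟩⟩
  · refine hQ _ _ (fun y h15 h16 h19 => by simp [h15, h16, h19]) rfl ?_ (by omega)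
    simp only [Store.reg_setReg, Nat.reduceEqDiff, if_true, if_false, h0]
    refine ⟨Nat.zero_le _, g + 1, ?_, by omega⟩
    rw [mul_add]
    omega
  · refine hQ _ _ (fun y h15 _ h19 => by simp [h15, h19]) rfl ?_ (by omega)
    simp only [Store.reg_setReg, Nat.reduceEqDiff, if_true, if_false, h0]
    exact ⟨by omega, g, by omega, by omega⟩
  · refine hQ _ _ (fun y _ h16 h19 => by simp [h16, h19]) rfl ?_ (by omega)
    simp only [Store.reg_setReg, Nat.reduceEqDiff, if_true, if_false, h0]
    exact ⟨by omega, g, by omega, by omega⟩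

/-- Count the neighbours of the vertex in register `9` that have the same parent, whose position
is in register `18`; register `17` becomes nonzero if one of them has a smaller position than the
number in register `4`. -/
def countSiblings : Prog :=
  scan <| .seq (.load 19 4 7) <| .ite (.eq 19 18)
    (.seq (.load 19 3 7) <| .seq (.ite (.lt 19 4) (.const 17 1) .skip) (countVertex 7)) .skip

/-- Decide about the block whose vertices are counted: the number of cliques that meet it is one
more than the number in register `16`, and the parent lies in a clique inside the block exactly if
`d` free vertices are left over. -/
def closeBlock : Prog :=
  .seq (.ite (.lt 16 13) .skip (.const 14 0)) <| .ite (.eq 15 10) .skip <| .ite (.eq 15 12)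
    (.seq (.load 8 2 18) <| .seq (.load 19 5 8) <| .seq (.add 19 19 1) (.store 5 8 19))
    (.const 14 0)

/-- Evaluate the block of the vertex in register `9` and its parent if the vertex is its head. -/
def evalBlock : Prog :=
  .seq (.const 15 0) <| .seq (.const 16 0) <| .seq (.const 17 0) <| .seq (countVertex 9) <|
  .seq countSiblings <| .ite (.eq 17 10) closeBlock .skip

/-- Evaluate the vertex at the position in register `4`. -/
def evalVertex : Prog :=
  .seq (.load 9 2 4) <| .seq (.load 18 4 9) <| .seq (.load 8 5 9) <|
  .seq (.ite (.lt 1 8) (.const 14 0) .skip) <|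
  .seq (.ite (.eq 18 10) (.ite (.eq 8 10) (.const 14 0) .skip) evalBlock) <| .sub 4 4 1

/-- The number of vertices `w` among `v` and the members of `l` with the parent of `v` that
satisfy `P`. -/
def countSib (par : ℕ → ℕ) (l : List ℕ) (v : ℕ) (P : ℕ → Prop) [DecidablePred P] : ℕ :=
  (if P v then 1 else 0) + l.countP fun w => par w = par v ∧ P w

theorem countSib_append_singleton (par : ℕ → ℕ) (l : List ℕ) (v w : ℕ) (P : ℕ → Prop)
    [DecidablePred P] : countSib par (l ++ [w]) v P =
      countSib par l v P + if par w = par v ∧ P w then 1 else 0 := by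
  simp [countSib, List.countP_append, List.countP_singleton, add_assoc]

theorem countSib_add_le (par : ℕ → ℕ) (l : List ℕ) (v : ℕ) (P : ℕ → Prop) [DecidablePred P] :
    countSib par l v P + countSib par l v (fun w => ¬ P w) ≤ l.length + 1 := by
  induction l with
  | nil => by_cases hv : P v <;> simp [countSib, hv]
  | cons w l ih =>
    simp only [countSib, List.countP_cons, List.length_cons, decide_eq_true_eq] at ih ⊢
    have : ((if par w = par v ∧ P w then 1 else 0) +
        if par w = par v ∧ ¬ P w then 1 else 0) ≤ 1 := by
      by_cases hw : P w <;>
        simp only [hw, and_true, and_false, not_true, not_false_iff, if_false] <;>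
        split_ifs <;> simp
    omega

/-- The values in the machine while the positions up to `i` are still to be evaluated. -/
structure EvalFrame (n : ℕ) (offset target : ℕ → ℕ) (k d : ℕ) (ord idx par : ℕ → ℕ) (i ok : ℕ)
    (cov : ℕ → ℕ) (σ : Store) : Prop where
  constants : Constants n offset target k d ok cov σ
  reg4 : σ.reg 4 = i
  arr2 : σ.arr 2 = ord
  arr3 : σ.arr 3 = idx
  arr4 : σ.arr 4 = par

/-- The counters while the siblings of `v` are counted, `l` being the list of neighbours seen. -/
structure CountFrame (d : ℕ) (idx par cov : ℕ → ℕ) (i v : ℕ) (l : List ℕ) (σ : Store) : Prop where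
  reg9 : σ.reg 9 = v
  reg18 : σ.reg 18 = par v
  reg17 : σ.reg 17 = 0 ↔ ∀ w ∈ l, par w = par v → i ≤ idx w
  counted : Counted d (countSib par l v fun w => cov w = 0) (countSib par l v fun w => ¬ cov w = 0)
    (σ.reg 15) (σ.reg 16)

section

variable {W n k d ok : ℕ} {N : ℕ → List ℕ} {offset target ord idx par cov : ℕ → ℕ}

theorem wp_countSiblings (hL : IsListing n N offset target) (hW : offset n + n + d + 4 ≤ W)
    (hidx : ∀ v < n, idx v ≤ n) (hpar : ∀ v < n, par v ≤ n) (hcov : ∀ v < n, cov v ≤ n)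
    {Q : Store → ℕ → Prop} {v i : ℕ} (hv : v < n) {σ : Store} {t : ℕ}
    (hE : EvalFrame n offset target k d ord idx par i ok cov σ)
    (hF : CountFrame d idx par cov i v [] σ)
    (hQ : ∀ σ' t', EvalFrame n offset target k d ord idx par i ok cov σ' →
      CountFrame d idx par cov i v (N v) σ' → t' ≤ t + 7 + 25 * (N v).length → Q σ' t') :
    wp W countSiblings Q σ t := by
  have hlen : (N v).length ≤ offset n := by
    have h1 := hL.offset_succ v hv
    have h2 := hL.offset_le (v + 1) hv
    omega
  refine wp_scan hL (by omega) hv (fun a σ t' =>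
    EvalFrame n offset target k d ord idx par i ok cov σ ∧
    CountFrame d idx par cov i v ((N v).take a) σ ∧ t' ≤ t + 6 + 25 * a)
    hE.constants.reg1 hF.reg9 hE.constants.arr0 hE.constants.arr1 ⟨?_, ?_, le_rfl⟩ ?_ ?_
  · constructor
    · exact hE.constants.of_eq (by simp) (by simp)
    all_goals simp [hE.reg4, hE.arr2, hE.arr3, hE.arr4]
  · constructor
    · simp [hF.reg9]
    · simp [hF.reg18]
    · simpa using hF.reg17
    · simpa using hF.counted
  · rintro a ha σ₁ t₁ ⟨hE₁, hF₁, ht₁⟩ hS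
    set w := (N v)[a] with hw_def
    have hwn : w < n := hL.mem_lt v w (List.getElem_mem ha)
    have htake : (N v).take (a + 1) = (N v).take a ++ [w] := by
      rw [List.take_succ_eq_append_getElem ha]
    have hcount_le := countSib_add_le par ((N v).take a) v (fun w => cov w = 0)
    rw [List.length_take, Nat.min_eq_left ha.le] at hcount_le
    have h1 := hidx w hwn
    have h2 := hpar w hwn
    have h3 := hcov w hwn
    simp only [wp, Test.eval, Store.reg_setReg, Store.arr_setReg, Nat.reduceEqDiff, if_true,
      if_false, hE₁.arr4, hE₁.arr3, hE₁.reg4, hF₁.reg18, decide_eq_true_eq,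
      decide_eq_false_iff_not]
    -- Both ways to reach `countVertex` end in the same way.
    have finish : ∀ (σ₂ : Store) (t₂ : ℕ), par w = par v →
        (σ₂.reg 17 = 0 ↔ σ₁.reg 17 = 0 ∧ i ≤ idx w) → σ₂.reg 7 = w →
        (∀ y, y ≠ 7 → y ≠ 17 → y ≠ 19 → σ₂.reg y = σ₁.reg y) → σ₂.arr = σ₁.arr →
        t₂ ≤ t₁ + 12 → wp W (countVertex 7) (fun σ' t' => ScanFrame offset target v a σ' ∧
          EvalFrame n offset target k d ord idx par i ok cov (σ'.setReg 5 (offset v + a + 1)) ∧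
          CountFrame d idx par cov i v ((N v).take (a + 1)) (σ'.setReg 5 (offset v + a + 1)) ∧
          t' + 1 ≤ t + 6 + 25 * (a + 1)) σ₂ t₂ := by
      intro σ₂ t₂ hp h17 h7 hreg harr ht₂
      have hC₂ : Constants n offset target k d ok cov σ₂ :=
        hE₁.constants.of_eq (by simp [hreg]) (by simp [harr])
      refine wp_countVertex hC₂ (by rw [h7]; omega) (by omega) ?_
        (F := countSib par ((N v).take a) v fun w => cov w = 0) (E := countSib par ((N v).take a) v fun w => ¬ cov w = 0) ?_ ?_
      · omega
      · rw [hreg 15 (by simp) (by simp) (by simp), hreg 16 (by simp) (by simp) (by simp)]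
        exact hF₁.counted
      · intro σ₃ t₃ hreg₃ harr₃ hcounted ht₃
        rw [h7] at hcounted
        refine ⟨?_, ⟨?_, ?_, ?_, ?_, ?_⟩, ⟨?_, ?_, ?_, ?_⟩, by omega⟩
        · constructor <;> simp [hreg₃, hreg, harr₃, harr, hS.reg1, hS.reg5, hS.reg6, hS.arr0,
            hS.arr1]
        · exact hE₁.constants.of_eq (by simp [hreg₃, hreg]) (by simp [harr₃, harr])
        · simp [hreg₃, hreg, hE₁.reg4]
        · simp [harr₃, harr, hE₁.arr2]
        · simp [harr₃, harr, hE₁.arr3]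
        · simp [harr₃, harr, hE₁.arr4]
        · simp [hreg₃, hreg, hF₁.reg9]
        · simp [hreg₃, hreg, hF₁.reg18]
        · simp only [Store.reg_setReg, Nat.reduceEqDiff, if_false]
          rw [hreg₃ 17 (by simp) (by simp) (by simp), h17, hF₁.reg17, htake]
          simp only [List.mem_append, List.mem_singleton]
          constructor
          · rintro ⟨h4, h5⟩ x (hx | rfl) hpx
            · exact h4 x hx hpx
            · exact h5
          · exact fun h => ⟨fun x hx => h x (Or.inl hx), h w (Or.inr rfl) hp⟩
        · simp only [Store.reg_setReg, Nat.reduceEqDiff, if_false]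
          rw [htake, countSib_append_singleton, countSib_append_singleton]
          by_cases h0 : cov w = 0 <;> simpa [h0, hp] using hcounted
    refine ⟨by omega, fun hp => ⟨by omega, fun hlt => ⟨by omega, ?_⟩, fun hlt => ?_⟩, fun hp => ?_⟩
    · refine finish _ _ hp ?_ (by simp) (fun y h7 h17 h19 => by simp [h7, h17, h19]) rfl (by omega)
      simp [hlt]
    · refine finish _ _ hp ?_ (by simp) (fun y h7 h17 h19 => by simp [h7, h19]) rfl (by omega)
      simp [not_lt.1 hlt]
    · refine ⟨?_, ⟨?_, ?_, ?_, ?_, ?_⟩, ⟨?_, ?_, ?_, ?_⟩, by omega⟩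
      · constructor <;> simp [hS.reg1, hS.reg5, hS.reg6, hS.arr0, hS.arr1]
      · exact hE₁.constants.of_eq (by simp) (by simp)
      · simp [hE₁.reg4]
      · simp [hE₁.arr2]
      · simp [hE₁.arr3]
      · simp [hE₁.arr4]
      · simp [hF₁.reg9]
      · simp [hF₁.reg18]
      · simp only [Store.reg_setReg, Nat.reduceEqDiff, if_false]
        rw [hF₁.reg17, htake]
        simp only [List.mem_append, List.mem_singleton]
        constructor
        · rintro h4 x (hx | rfl) hpx
          · exact h4 x hx hpx
          · exact absurd hpx hp
        · exact fun h x hx => h x (Or.inl hx)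
      · simp only [Store.reg_setReg, Nat.reduceEqDiff, if_false]
        rw [htake, countSib_append_singleton, countSib_append_singleton]
        simpa [hp] using hF₁.counted
  · rintro σ₁ t₁ ⟨hE₁, hF₁, ht₁⟩ -
    rw [List.take_length] at hF₁
    exact hQ _ _ hE₁ hF₁ (by omega)

/-- The vertex `v` is the head of a block whose parent is covered by a clique of this block. -/
def Covers (N : ℕ → List ℕ) (d : ℕ) (idx par cov : ℕ → ℕ) (v : ℕ) : Prop :=
  par v ≠ 0 ∧ (∀ w ∈ N v, par w = par v → idx v ≤ idx w) ∧
    countSib par (N v) v (fun w => cov w = 0) % (d + 1) = d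

/-- The conditions on the block of a head `v` in the counting criterion. -/
def BlockPasses (N : ℕ → List ℕ) (k d : ℕ) (idx par cov : ℕ → ℕ) (v : ℕ) : Prop :=
  par v ≠ 0 → (∀ w ∈ N v, par w = par v → idx v ≤ idx w) →
    (countSib par (N v) v (fun w => cov w = 0) % (d + 1) = 0 ∨
      countSib par (N v) v (fun w => cov w = 0) % (d + 1) = d) ∧
    countSib par (N v) v (fun w => ¬ cov w = 0) +
      countSib par (N v) v (fun w => cov w = 0) / (d + 1) < k

/-- The conditions on `v` in the counting criterion. -/
def Passes (N : ℕ → List ℕ) (k d : ℕ) (idx par cov : ℕ → ℕ) (v : ℕ) : Prop :=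
  cov v ≤ 1 ∧ (par v = 0 → cov v ≠ 0) ∧ BlockPasses N k d idx par cov v

theorem wp_closeBlock (hW : n + 1 ≤ W) (hd : 0 < d) (hcov : ∀ v < n, cov v ≤ n)
    {Q : Store → ℕ → Prop} {v : ℕ} (hv : par v ≠ 0) (hord : ord (par v) < n) {σ : Store} {t : ℕ}
    (hE : EvalFrame n offset target k d ord idx par (idx v) ok cov σ)
    (hF : CountFrame d idx par cov (idx v) v (N v) σ) (h17 : σ.reg 17 = 0)
    (hQ : ∀ σ' t' ok' cov', EvalFrame n offset target k d ord idx par (idx v) ok' cov' σ' →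
      (BlockPasses N k d idx par cov v → ok' = ok) →
      (¬ BlockPasses N k d idx par cov v → ok' = 0) →
      (Covers N d idx par cov v →
        cov' = Function.update cov (ord (par v)) (cov (ord (par v)) + 1)) →
      (¬ Covers N d idx par cov v → cov' = cov) → t' ≤ t + 12 → Q σ' t') :
    wp W closeBlock Q σ t := by
  have hhead := hF.reg17.1 h17
  have hp : BlockPasses N k d idx par cov v ↔
      (σ.reg 15 = 0 ∨ σ.reg 15 = d) ∧ σ.reg 16 < k := by
    rw [BlockPasses, hF.counted.mod_eq, hF.counted.add_div_eq]
    exact ⟨fun h => h hv hhead, fun h _ _ => h⟩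
  have hc : Covers N d idx par cov v ↔ σ.reg 15 = d := by
    rw [Covers, hF.counted.mod_eq]
    exact ⟨fun h => h.2.2, fun h => ⟨hv, hhead, h⟩⟩
  rw [hp, hc] at hQ
  have hC := hE.constants
  have hco := hcov _ hord
  -- The remaining part is the same for both outcomes of the comparison with `k`.
  have rest : ∀ (σ₁ : Store) (t₁ ok₁ : ℕ), (∀ y, y ≠ 14 → σ₁.reg y = σ.reg y) → σ₁.arr = σ.arr →
      σ₁.reg 14 = ok₁ → (σ.reg 16 < k → ok₁ = ok) → (¬ σ.reg 16 < k → ok₁ = 0) → t₁ ≤ t + 3 →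
      wp W (.ite (.eq 15 10) .skip <| .ite (.eq 15 12)
        (.seq (.load 8 2 18) <| .seq (.load 19 5 8) <| .seq (.add 19 19 1) (.store 5 8 19))
        (.const 14 0)) Q σ₁ t₁ := by
    intro σ₁ t₁ ok₁ hreg harr h14 hlt hnlt ht₁
    have hframe : EvalFrame n offset target k d ord idx par (idx v) ok₁ cov σ₁ := by
      refine ⟨⟨?_, ?_, ?_, ?_, ?_, ?_, h14, ?_, ?_, ?_⟩, ?_, ?_, ?_, ?_⟩ <;>
        simp [hreg, harr, hC.reg0, hC.reg1, hC.reg10, hC.reg11, hC.reg12, hC.reg13, hC.arr0,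
          hC.arr1, hC.arr5, hE.reg4, hE.arr2, hE.arr3, hE.arr4]
    have hC₁ := hframe.constants
    have h15 : σ₁.reg 15 = σ.reg 15 := hreg 15 (by simp)
    have h18 : σ₁.reg 18 = par v := (hreg 18 (by simp)).trans hF.reg18
    simp only [wp, Test.eval, Store.reg_setReg, Store.arr_setReg, Nat.reduceEqDiff, if_true,
      if_false, hC₁.reg10, hC₁.reg12, hC₁.reg1, h15, h18, hframe.arr2, hC₁.arr5, decide_eq_true_eq,
      decide_eq_false_iff_not, OfNat.one_ne_ofNat]
    refine ⟨fun h0 => ?_, fun h0 => ⟨fun h1 => ⟨by omega, by omega, by omega,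
      ⟨by omega, by omega⟩, ?_⟩, fun h1 => ⟨by omega, ?_⟩⟩⟩
    · refine hQ _ _ ok₁ cov hframe ?_ ?_ ?_ ?_ (by omega)
      · exact fun h => hlt h.2
      · exact fun h => hnlt fun h' => h ⟨Or.inl h0, h'⟩
      · intro h
        omega
      · exact fun _ => rfl
    · refine hQ _ _ ok₁ (Function.update cov (ord (par v)) (cov (ord (par v)) + 1)) ?_ ?_ ?_
        (fun _ => rfl) (fun h => absurd h1 h) (by omega)
      · refine ⟨?_, ?_, ?_, ?_, ?_⟩
        · constructor <;> simp [hC₁.reg0, hC₁.reg1, hC₁.reg10, hC₁.reg11, hC₁.reg12, hC₁.reg13,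
            hC₁.reg14, hC₁.arr0, hC₁.arr1, hC₁.arr5]
        all_goals simp [hframe.reg4, hframe.arr2, hframe.arr3, hframe.arr4]
      · exact fun h => hlt h.2
      · exact fun h => hnlt fun h' => h ⟨Or.inr h1, h'⟩
    · refine hQ _ _ 0 cov ?_ (fun h => ?_) (fun _ => rfl) (fun h => absurd h h1) (fun _ => rfl)
        (by omega)
      · refine ⟨?_, ?_, ?_, ?_, ?_⟩
        · constructor <;> simp [hC₁.reg0, hC₁.reg1, hC₁.reg10, hC₁.reg11, hC₁.reg12, hC₁.reg13,
            hC₁.arr0, hC₁.arr1, hC₁.arr5]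
        all_goals simp [hframe.reg4, hframe.arr2, hframe.arr3, hframe.arr4]
      · exact absurd h.1 (by tauto)
  rw [closeBlock, wp_seq, wp_ite, wp_skip, wp_const]
  simp only [Test.eval, hC.reg13, decide_eq_true_eq, decide_eq_false_iff_not]
  refine ⟨fun hlt => ?_, fun hlt => ⟨Nat.zero_le _, ?_⟩⟩
  · exact rest _ _ ok (fun _ _ => rfl) rfl hC.reg14 (fun _ => rfl) (fun h => absurd hlt h)
      (by omega)
  · exact rest _ _ 0 (fun y hy => by simp [hy]) rfl (by simp) (fun h => absurd h hlt)
      (fun _ => rfl) (by omega)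

theorem wp_evalBlock (hL : IsListing n N offset target) (hW : offset n + n + d + 4 ≤ W)
    (hd : 0 < d) (hidx : ∀ v < n, idx v ≤ n) (hpar : ∀ v < n, par v ≤ n) (hcov : ∀ v < n, cov v ≤ n)
    {Q : Store → ℕ → Prop} {v : ℕ} (hvn : v < n) (hv : par v ≠ 0) (hord : ord (par v) < n)
    {σ : Store} {t : ℕ} (hE : EvalFrame n offset target k d ord idx par (idx v) ok cov σ)
    (h9 : σ.reg 9 = v) (h18 : σ.reg 18 = par v)
    (hQ : ∀ σ' t' ok' cov', EvalFrame n offset target k d ord idx par (idx v) ok' cov' σ' →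
      (BlockPasses N k d idx par cov v → ok' = ok) →
      (¬ BlockPasses N k d idx par cov v → ok' = 0) →
      (Covers N d idx par cov v →
        cov' = Function.update cov (ord (par v)) (cov (ord (par v)) + 1)) →
      (¬ Covers N d idx par cov v → cov' = cov) → t' ≤ t + 40 + 25 * (N v).length → Q σ' t') :
    wp W evalBlock Q σ t := by
  have hcv := hcov v hvn
  simp only [evalBlock, wp_seq, wp_const]
  refine ⟨Nat.zero_le _, Nat.zero_le _, Nat.zero_le _, ?_⟩
  refine wp_countVertex (k := k) (d := d) (ok := ok) (cov := cov) (F := 0) (E := 0)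
    (hE.constants.of_eq (by simp) (by simp)) (by simp [h9]; omega) (by omega) (by omega)
    ⟨by simp, 0, by simp, by simp⟩ ?_
  intro σ₁ t₁ hreg harr hcount ht₁
  simp only [Store.reg_setReg, Nat.reduceEqDiff, if_false, h9, zero_add] at hcount
  refine wp_countSiblings (k := k) (d := d) (ok := ok) (i := idx v) (ord := ord) (idx := idx)
    (par := par) (cov := cov) hL hW hidx hpar hcov hvn ?_ ?_ ?_
  · refine ⟨hE.constants.of_eq (by simp [hreg]) (by simp [harr]), ?_, ?_, ?_, ?_⟩
    · simp [hreg, hE.reg4]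
    · simp [harr, hE.arr2]
    · simp [harr, hE.arr3]
    · simp [harr, hE.arr4]
  · refine ⟨?_, ?_, ?_, ?_⟩
    · simp [hreg, h9]
    · simp [hreg, h18]
    · simp [hreg]
    · by_cases h0 : cov v = 0 <;> simpa [countSib, h0] using hcount
  intro σ₂ t₂ hE₂ hF₂ ht₂
  rw [wp_ite]
  simp only [Test.eval, hE₂.constants.reg10, decide_eq_true_eq, decide_eq_false_iff_not]
  refine ⟨fun h17 => ?_, fun h17 => ?_⟩
  · refine wp_closeBlock (by omega) hd hcov hv hord hE₂ hF₂ h17 ?_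
    intro σ₃ t₃ ok₃ cov₃ hE₃ h1 h2 h3 h4 ht₃
    exact hQ _ _ _ _ hE₃ h1 h2 h3 h4 (by omega)
  · rw [hF₂.reg17] at h17
    refine hQ _ _ ok cov hE₂ (fun _ => rfl) (fun h => absurd (fun _ h' => absurd h' h17) h)
      (fun h => absurd h.2.1 h17) (fun _ => rfl) (by omega)

theorem wp_evalVertex (hL : IsListing n N offset target) (hW : offset n + n + d + 4 ≤ W)
    (hd : 0 < d) (hidx : ∀ v < n, idx v ≤ n) (hpar : ∀ v < n, par v ≤ n) (hcov : ∀ v < n, cov v ≤ n)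
    {Q : Store → ℕ → Prop} {v : ℕ} (hvn : v < n) (hv : ord (idx v) = v)
    (hord : par v ≠ 0 → ord (par v) < n) {σ : Store} {t : ℕ}
    (hE : EvalFrame n offset target k d ord idx par (idx v) ok cov σ)
    (hQ : ∀ σ' t' ok' cov', EvalFrame n offset target k d ord idx par (idx v - 1) ok' cov' σ' →
      (Passes N k d idx par cov v → ok' = ok) → (¬ Passes N k d idx par cov v → ok' = 0) →
      (Covers N d idx par cov v →
        cov' = Function.update cov (ord (par v)) (cov (ord (par v)) + 1)) →
      (¬ Covers N d idx par cov v → cov' = cov) → t' ≤ t + 55 + 25 * (N v).length → Q σ' t') :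
    wp W evalVertex Q σ t := by
  have hcv := hcov v hvn
  have hpv := hpar v hvn
  have hiv := hidx v hvn
  have hC := hE.constants
  -- The part after the test whether `cov v ≤ 1`, which may set register `14` to `0`.
  have rest : ∀ (σ₁ : Store) (t₁ ok₁ : ℕ),
      EvalFrame n offset target k d ord idx par (idx v) ok₁ cov σ₁ → σ₁.reg 9 = v →
      σ₁.reg 18 = par v → σ₁.reg 8 = cov v → (cov v ≤ 1 → ok₁ = ok) → (¬ cov v ≤ 1 → ok₁ = 0) →
      t₁ ≤ t + 9 → wp W (.seq (.ite (.eq 18 10) (.ite (.eq 8 10) (.const 14 0) .skip) evalBlock) <|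
        .sub 4 4 1) Q σ₁ t₁ := by
    intro σ₁ t₁ ok₁ hE₁ h9 h18 h8 hle hnle ht₁
    have hC₁ := hE₁.constants
    rw [wp_seq, wp_ite]
    have final : ∀ (σ₂ : Store) (t₂ ok₂ : ℕ) (cov₂ : ℕ → ℕ),
        EvalFrame n offset target k d ord idx par (idx v) ok₂ cov₂ σ₂ →
        (Passes N k d idx par cov v → ok₂ = ok) → (¬ Passes N k d idx par cov v → ok₂ = 0) →
        (Covers N d idx par cov v →
          cov₂ = Function.update cov (ord (par v)) (cov (ord (par v)) + 1)) →
        (¬ Covers N d idx par cov v → cov₂ = cov) → t₂ ≤ t + 54 + 25 * (N v).length →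
        wp W (.sub 4 4 1) Q σ₂ t₂ := by
      intro σ₂ t₂ ok₂ cov₂ hE₂ h1 h2 h3 h4 ht₂
      have hC₂ := hE₂.constants
      rw [wp_sub, hE₂.reg4, hC₂.reg1]
      refine ⟨by omega, hQ _ _ ok₂ cov₂ ⟨hC₂.of_eq (by simp) (by simp), ?_, ?_, ?_, ?_⟩ h1 h2 h3 h4
        (by omega)⟩ <;> simp [hE₂.arr2, hE₂.arr3, hE₂.arr4]
    simp only [Test.eval, hC₁.reg10, h18, decide_eq_true_eq, decide_eq_false_iff_not]
    refine ⟨fun h0 => ?_, fun h0 => ?_⟩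
    · have hcover : ¬ Covers N d idx par cov v := fun h => h.1 h0
      simp only [wp_ite, wp_const, wp_skip, Test.eval, hC₁.reg10, h8, decide_eq_true_eq,
        decide_eq_false_iff_not]
      refine ⟨fun h1 => ⟨Nat.zero_le _, ?_⟩, fun h1 => ?_⟩
      · refine final _ _ 0 cov ?_ (fun h => absurd h1 (h.2.1 h0)) (fun _ => rfl)
          (fun h => absurd h hcover) (fun _ => rfl) (by omega)
        refine ⟨?_, ?_, ?_, ?_, ?_⟩
        · constructor <;> simp [hC₁.reg0, hC₁.reg1, hC₁.reg10, hC₁.reg11, hC₁.reg12, hC₁.reg13,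
            hC₁.arr0, hC₁.arr1, hC₁.arr5]
        all_goals simp [hE₁.reg4, hE₁.arr2, hE₁.arr3, hE₁.arr4]
      · refine final _ _ ok₁ cov hE₁ (fun h => hle h.1) (fun h => hnle fun h' => h ?_)
          (fun h => absurd h hcover) (fun _ => rfl) (by omega)
        exact ⟨h', fun _ => h1, fun h => absurd h0 h⟩
    · refine wp_evalBlock hL hW hd hidx hpar hcov hvn h0 (hord h0) hE₁ h9 h18 ?_
      intro σ₂ t₂ ok₂ cov₂ hE₂ h1 h2 h3 h4 ht₂
      refine final _ _ ok₂ cov₂ hE₂ (fun h => (h1 h.2.2).trans (hle h.1)) (fun h => ?_) h3 h4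
        (by omega)
      by_cases hb : BlockPasses N k d idx par cov v
      · rw [h1 hb]
        exact hnle fun h' => h ⟨h', fun h => absurd h h0, hb⟩
      · exact h2 hb
  simp only [evalVertex, wp_seq (p := .load _ _ _), wp_load, Store.reg_setReg, Store.arr_setReg,
    Nat.reduceEqDiff, if_true, if_false, hE.reg4, hE.arr2, hE.arr4, hC.arr5, hv]
  refine ⟨by omega, by omega, by omega, ?_⟩
  rw [wp_seq, wp_ite]
  simp only [wp_const, wp_skip, Test.eval, Store.reg_setReg, Nat.reduceEqDiff, if_true, if_false,
    OfNat.one_ne_ofNat, hC.reg1, decide_eq_true_eq, decide_eq_false_iff_not]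
  refine ⟨fun h1 => ⟨Nat.zero_le _, ?_⟩, fun h1 => ?_⟩
  · refine rest _ _ 0 ?_ ?_ ?_ ?_ (fun h => absurd h1 (by omega)) (fun _ => rfl) (by omega)
    · refine ⟨?_, ?_, ?_, ?_, ?_⟩
      · constructor <;> simp [hC.reg0, hC.reg1, hC.reg10, hC.reg11, hC.reg12, hC.reg13,
          hC.arr0, hC.arr1, hC.arr5]
      all_goals simp [hE.reg4, hE.arr2, hE.arr3, hE.arr4]
    all_goals simp
  · refine rest _ _ ok ?_ ?_ ?_ ?_ (fun _ => rfl) (fun h => absurd h1 (by omega)) (by omega)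
    · refine ⟨hC.of_eq (by simp) (by simp), ?_, ?_, ?_, ?_⟩ <;>
        simp [hE.reg4, hE.arr2, hE.arr3, hE.arr4]
    all_goals simp

end

end RAM

/-! ### Evaluating the criterion -/

namespace RAM

open Finset SimpleGraph

section

variable {n k d : ℕ} {G : SimpleGraph (Fin n)} {nbr : Fin n → List (Fin n)} {ord idx par : ℕ → ℕ}

theorem mem_neighborList_iff_adj (hnbr : G.IsAdjacencyList nbr) {v w : Fin n} :
    (w : ℕ) ∈ neighborList nbr v ↔ G.Adj v w := by
  rw [mem_neighborList, ← (hnbr v).2 w]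
  exact ⟨fun ⟨_, _, h⟩ => h, fun h => ⟨v.2, w.2, h⟩⟩

theorem mem_neighborList_symm (hnbr : G.IsAdjacencyList nbr) (v w : ℕ)
    (h : w ∈ neighborList nbr v) : v ∈ neighborList nbr w := by
  obtain ⟨hv, hw, -⟩ := mem_neighborList.1 h
  exact (mem_neighborList_iff_adj hnbr (v := ⟨w, hw⟩) (w := ⟨v, hv⟩)).2
    ((mem_neighborList_iff_adj hnbr (v := ⟨v, hv⟩) (w := ⟨w, hw⟩)).1 h).symm

theorem SearchInv.isSearchOrder (hnbr : G.IsAdjacencyList nbr)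
    (h : SearchInv n (neighborList nbr) ord idx par n n) (hall : ∀ v < n, idx v ≠ 0) :
    G.IsSearchOrder (fun v => idx v) (fun v => par v) := by
  constructor
  · intro v w hvw
    have h1 := (h.idx_spec v (hall v v.2)).2.2
    have h2 := (h.idx_spec w (hall w w.2)).2.2
    simp only at hvw
    rw [hvw] at h1
    exact Fin.ext (h1.symm.trans h2)
  · exact fun v => Nat.pos_of_ne_zero (hall v v.2)
  · intro v hv
    obtain ⟨h1, h2⟩ := h.par_spec v hv
    have h3 := (h.idx_spec v (hall v v.2)).2.1
    obtain ⟨h4, h5⟩ := h.ord_spec (par v) (Nat.pos_of_ne_zero hv) (by omega)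
    exact ⟨⟨_, h4⟩, h5, (mem_neighborList_iff_adj hnbr (v := ⟨_, h4⟩)).1 h2, h1⟩
  · exact fun v w hv hvw =>
      h.first v w hv ((mem_neighborList_iff_adj hnbr).2 hvw) (hall w w.2)
  · exact fun r v w hr hvw hlt =>
      (h.root r v w (hall r r.2) hr ((mem_neighborList_iff_adj hnbr).2 hvw) (hall v v.2) hlt).2

theorem countSib_eq_card (hnbr : G.IsAdjacencyList nbr) (v : Fin n) (P : ℕ → Prop)
    [DecidablePred P] : countSib par (neighborList nbr v) v P =
      #((G.siblings (fun v => par v) v).filter fun w : Fin n => P w) := by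
  classical
  have h1 : (neighborList nbr v).countP (fun w => par w = par v ∧ P w) =
      #((nbr v).toFinset.filter fun w : Fin n => par w = par v ∧ P w) := by
    rw [neighborList, dif_pos v.2, List.countP_map, List.countP_eq_length_filter,
      ← List.toFinset_card_of_nodup ((hnbr v).1.filter _), List.toFinset_filter]
    simp
  have h2 : (G.siblings (fun v => par v) v).filter (fun w : Fin n => P w) =
      (if P v then {v} else ∅) ∪
        (nbr v).toFinset.filter fun w : Fin n => par w = par v ∧ P w := by
    ext w
    rw [mem_filter, mem_siblings, mem_union, mem_filter, List.mem_toFinset, (hnbr v).2]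
    by_cases hwv : w = v
    · subst hwv
      by_cases hP : P w <;> simp [hP]
    · by_cases hP : P v <;> simp [hP, hwv] <;> tauto
  rw [countSib, h1, h2, card_union_of_disjoint]
  · by_cases hP : P v <;> simp [hP]
  · rw [Finset.disjoint_left]
    intro w hw hw'
    have hwv : w = v := by
      split_ifs at hw
      · exact mem_singleton.1 hw
      · exact absurd hw (notMem_empty w)
    rw [mem_filter, List.mem_toFinset, (hnbr v).2, hwv] at hw'
    exact G.loopless.irrefl _ hw'.1

theorem isHead_iff (hnbr : G.IsAdjacencyList nbr) {v : Fin n} :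
    G.IsHead (fun v => idx v) (fun v => par v) v ↔
      par v ≠ 0 ∧ ∀ w ∈ neighborList nbr v, par w = par v → idx v ≤ idx w := by
  refine and_congr_right fun _ => ⟨fun h w hw hp => ?_, fun h w hw => ?_⟩
  · obtain ⟨-, hwn, -⟩ := mem_neighborList.1 hw
    exact h ⟨w, hwn⟩ (mem_siblings.2
      ⟨hp, Or.inr ((mem_neighborList_iff_adj hnbr (w := ⟨w, hwn⟩)).1 hw)⟩)
  · rw [mem_siblings] at hw
    rcases hw with ⟨hp, rfl | hw⟩
    · exact le_rfl
    · exact h w ((mem_neighborList_iff_adj hnbr).2 hw) hp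

/-- The conditions on `v` in the counting criterion. -/
def IsFeasibleAt (G : SimpleGraph (Fin n)) (k d : ℕ) (idx par cov : Fin n → ℕ) (v : Fin n) : Prop :=
  cov v ≤ 1 ∧ (par v = 0 → cov v ≠ 0) ∧ (G.IsHead idx par v →
    (G.freeCount par cov v % (d + 1) = 0 ∨ G.freeCount par cov v % (d + 1) = d) ∧
    G.coveredCount par cov v + G.freeCount par cov v / (d + 1) < k)

theorem isFeasible_iff_forall {idx par cov : Fin n → ℕ} :
    G.IsFeasible k d idx par cov ↔ ∀ v, IsFeasibleAt G k d idx par cov v :=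
  ⟨fun h v => ⟨h.le_one v, h.root v, fun hv => ⟨h.mod v hv, h.lt v hv⟩⟩,
    fun h => ⟨fun v => (h v).2.1, fun v => (h v).1, fun v hv => ((h v).2.2 hv).1,
      fun v hv => ((h v).2.2 hv).2⟩⟩

open scoped Classical in
/-- The number of heads after position `i` whose block covers their parent `v`. -/
noncomputable def coverCountAfter (G : SimpleGraph (Fin n)) (d : ℕ) (idx par cov : Fin n → ℕ)
    (i : ℕ) (v : Fin n) : ℕ :=
  #{b | (G.IsHead idx par b ∧ par b = idx v ∧ G.freeCount par cov b % (d + 1) = d) ∧ i < idx b}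

theorem coverCountAfter_eq {idx par cov : Fin n → ℕ} (h : G.IsSearchOrder idx par)
    (hcov : G.IsCoverCount d idx par cov) {i : ℕ} {v : Fin n} (hv : i ≤ idx v) :
    coverCountAfter G d idx par cov i v = cov v := by
  classical
  rw [hcov v, coverCountAfter]
  congr 1
  ext b
  simp only [mem_filter, mem_univ, true_and]
  refine ⟨fun hb => hb.1, fun hb => ⟨hb, ?_⟩⟩
  have := h.par_lt b
  omega

theorem coverCountAfter_le {idx par cov : Fin n → ℕ} (i : ℕ) (v : Fin n) :
    coverCountAfter G d idx par cov i v ≤ n := by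
  rw [coverCountAfter]
  exact (card_le_univ _).trans (by simp)

theorem coverCountAfter_pred {idx par cov : Fin n → ℕ} (h : G.IsSearchOrder idx par)
    {v : Fin n} (u : Fin n) : coverCountAfter G d idx par cov (idx v - 1) u =
      coverCountAfter G d idx par cov (idx v) u + open scoped Classical in
        if G.IsHead idx par v ∧ par v = idx u ∧ G.freeCount par cov v % (d + 1) = d
        then 1 else 0 := by
  classical
  have hpos := h.pos v
  have hlt : ∀ b, idx v - 1 < idx b ↔ b = v ∨ idx v < idx b := by
    intro b
    constructor
    · intro hb
      rcases (show idx v ≤ idx b by omega).eq_or_lt with he | he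
      · exact Or.inl (h.injective he).symm
      · exact Or.inr he
    · rintro (rfl | hb) <;> omega
  rw [coverCountAfter, coverCountAfter]
  split_ifs with hv
  · rw [← card_insert_of_notMem (a := v) (by simp)]
    congr 1
    ext b
    simp only [mem_filter, mem_univ, true_and, mem_insert, hlt]
    constructor
    · rintro ⟨h1, rfl | h2⟩
      · exact Or.inl rfl
      · exact Or.inr ⟨h1, h2⟩
    · rintro (rfl | ⟨h1, h2⟩)
      · exact ⟨hv, Or.inl rfl⟩
      · exact ⟨h1, Or.inr h2⟩
  · rw [add_zero]
    congr 1
    ext b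
    simp only [mem_filter, mem_univ, true_and, hlt]
    constructor
    · rintro ⟨h1, rfl | h2⟩
      · exact absurd h1 hv
      · exact ⟨h1, h2⟩
    · exact fun ⟨h1, h2⟩ => ⟨h1, Or.inr h2⟩

theorem card_siblings_congr {cov : ℕ → ℕ} {cov' : Fin n → ℕ} (hnbr : G.IsAdjacencyList nbr)
    {v : Fin n} (hcov : ∀ w ∈ G.siblings (fun v => par v) v, cov w = cov' w) :
    (countSib par (neighborList nbr v) v fun w => cov w = 0) =
      G.freeCount (fun v => par v) cov' v ∧
    (countSib par (neighborList nbr v) v fun w => ¬ cov w = 0) =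
      G.coveredCount (fun v => par v) cov' v := by
  rw [countSib_eq_card hnbr, countSib_eq_card hnbr]
  exact ⟨congrArg card (filter_congr fun w hw => by rw [hcov w hw]),
    congrArg card (filter_congr fun w hw => by rw [hcov w hw])⟩

/-- The conditions tested at `v` are those of the criterion, provided that the numbers of covering
blocks are final for all vertices that do not precede `v`. -/
theorem covers_iff_and_passes_iff {cov : ℕ → ℕ} {cov' : Fin n → ℕ} (hnbr : G.IsAdjacencyList nbr)
    {v : Fin n} (hcov : ∀ w : Fin n, idx v ≤ idx w → cov w = cov' w) :
    (Covers (neighborList nbr) d idx par cov v ↔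
      G.IsHead (fun v => idx v) (fun v => par v) v ∧
        G.freeCount (fun v => par v) cov' v % (d + 1) = d) ∧
    (Passes (neighborList nbr) k d idx par cov v ↔
      IsFeasibleAt G k d (fun v => idx v) (fun v => par v) cov' v) := by
  have hcount : G.IsHead (fun v => idx v) (fun v => par v) v → _ := fun hv =>
    card_siblings_congr (par := par) hnbr (v := v) fun w hw => hcov w (hv.2 w hw)
  constructor
  · rw [Covers, ← and_assoc, ← isHead_iff hnbr]
    exact and_congr_right fun hv => by rw [(hcount hv).1]
  · rw [Passes, IsFeasibleAt, BlockPasses, ← and_imp (a := par v ≠ 0), ← isHead_iff hnbr,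
      hcov v le_rfl]
    refine and_congr_right fun _ => and_congr_right fun _ => forall_congr' fun hv => ?_
    rw [(hcount hv).1, (hcount hv).2]

/-- Evaluate all vertices, from the last position to the first. -/
def evaluate : Prog := .while (.lt 10 4) evalVertex

/-- When the positions after `i` are evaluated, array `5` holds the numbers `coverCountAfter` for
`i`, which are final for the vertices from position `i` on. -/
theorem wp_evaluate {W : ℕ} {offset target : ℕ → ℕ} (hnbr : G.IsAdjacencyList nbr)
    (hL : IsListing n (neighborList nbr) offset target) (hW : offset n + n + d + 4 ≤ W)
    (hd : 0 < d) (h : SearchInv n (neighborList nbr) ord idx par n n) (hall : ∀ v < n, idx v ≠ 0)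
    {cov' : Fin n → ℕ} (hcov' : G.IsCoverCount d (fun v => idx v) (fun v => par v) cov')
    {Q : Store → ℕ → Prop} {σ : Store} {t : ℕ}
    (hE : EvalFrame n offset target k d ord idx par n 1 (fun _ => 0) σ)
    (hQ : ∀ σ' t', σ'.reg 14 ≤ W →
      (G.IsFeasible k d (fun v => idx v) (fun v => par v) cov' → σ'.reg 14 = 1) →
      (¬ G.IsFeasible k d (fun v => idx v) (fun v => par v) cov' → σ'.reg 14 = 0) →
      t' ≤ t + 60 * n + 25 * ∑ p ∈ range n, (neighborList nbr (ord (p + 1))).length + 1 → Q σ' t') :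
    wp W evaluate Q σ t := by
  classical
  have hS := h.isSearchOrder hnbr hall
  have hidx : ∀ v < n, idx v ≤ n := fun v hv => (h.idx_spec v (hall v hv)).2.1
  have hpar : ∀ v < n, par v ≤ n := fun v hv => (hS.par_lt ⟨v, hv⟩).le.trans (hidx v hv)
  set F := IsFeasibleAt G k d (fun v => idx v) (fun v => par v) cov' with hF
  refine wp_while (fun i σ' t' => i ≤ n ∧ ∃ ok cov,
    EvalFrame n offset target k d ord idx par i ok cov σ' ∧
    (∀ v : Fin n, cov v = coverCountAfter G d (fun v => idx v) (fun v => par v) cov' i v) ∧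
    ((∀ v : Fin n, i < idx v → F v) → ok = 1) ∧ (¬ (∀ v : Fin n, i < idx v → F v) → ok = 0) ∧
    t' + 60 * i + 25 * ∑ p ∈ range i, (neighborList nbr (ord (p + 1))).length ≤
      t + 60 * n + 25 * ∑ p ∈ range n, (neighborList nbr (ord (p + 1))).length) ?_
    ⟨le_rfl, 1, fun _ => 0, hE, ?_, fun _ => rfl, fun hno => absurd ?_ hno, le_rfl⟩
  · rintro i σ₁ t₁ ⟨hin, ok, cov, hE₁, hcov, hok, hnok, ht⟩
    simp only [Test.eval, hE₁.reg4, hE₁.constants.reg10, decide_eq_true_eq, decide_eq_false_iff_not]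
    constructor
    swap
    · intro hi
      obtain rfl : i = 0 := by omega
      have hiff : G.IsFeasible k d (fun v => idx v) (fun v => par v) cov' ↔
          ∀ v : Fin n, 0 < idx v → F v := by
        rw [isFeasible_iff_forall]
        exact ⟨fun h v _ => h v, fun h v => h v (Nat.pos_of_ne_zero (hall v v.2))⟩
      rw [hiff] at hQ
      have h14 := hE₁.constants.reg14
      refine hQ _ _ ?_ (fun h => h14.trans (hok h)) (fun h => h14.trans (hnok h)) (by omega)
      by_cases hF0 : ∀ v : Fin n, 0 < idx v → F v
      · rw [h14, hok hF0]
        omega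
      · rw [h14, hnok hF0]
        omega
    intro hi
    obtain ⟨hvn, hiv⟩ := h.ord_spec i hi hin
    obtain ⟨v, hv⟩ : ∃ v : Fin n, (v : ℕ) = ord i := ⟨⟨_, hvn⟩, rfl⟩
    rw [← hv] at hiv hvn
    subst hiv
    have hcovn : ∀ u < n, cov u ≤ n := fun u hu => by
      rw [hcov ⟨u, hu⟩]
      exact coverCountAfter_le _ _
    have hord : par v ≠ 0 → ord (par v) < n ∧ idx (ord (par v)) = par v := fun h0 =>
      h.ord_spec _ (Nat.pos_of_ne_zero h0) (hpar v hvn)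
    obtain ⟨hcovers, hpasses⟩ := covers_iff_and_passes_iff (k := k) (d := d) (par := par)
      (cov := cov) (cov' := cov') hnbr (v := v) fun w hw => by
        rw [hcov w, coverCountAfter_eq hS hcov' hw]
    refine wp_evalVertex hL hW hd hidx hpar hcovn hvn hv.symm (fun h0 => (hord h0).1) hE₁ ?_
    intro σ₂ t₂ ok₂ cov₂ hE₂ h1 h2 h3 h4 ht₂
    have hall_iff : (∀ w : Fin n, idx v - 1 < idx w → F w) ↔
        F v ∧ ∀ w : Fin n, idx v < idx w → F w := by
      constructor
      · exact fun hw => ⟨hw v (by omega), fun w hlt => hw w (by omega)⟩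
      · rintro ⟨hv, hw⟩ w hlt
        rcases (show idx v ≤ idx w by omega).eq_or_lt with he | he
        · rwa [← hS.injective he]
        · exact hw w he
    refine ⟨idx v - 1, by omega, by omega, ok₂, cov₂, hE₂, ?_, ?_, ?_, ?_⟩
    · intro u
      rw [coverCountAfter_pred hS (v := v) u, ← hcov u]
      by_cases hc : Covers (neighborList nbr) d idx par cov v
      · have hc' := hcovers.1 hc
        obtain ⟨ho1, ho2⟩ := hord hc'.1.1
        rw [h3 hc, Function.update_apply]
        by_cases hu : (u : ℕ) = ord (par v)
        · rw [if_pos hu, if_pos ⟨hc'.1, by rw [hu, ho2], hc'.2⟩, hu]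
        · rw [if_neg hu, if_neg, add_zero]
          rintro ⟨-, hpu, -⟩
          refine hu ?_
          rw [hpu]
          exact ((h.idx_spec u (hall u u.2)).2.2).symm
      · rw [h4 hc, if_neg, add_zero]
        exact fun h5 => hc (hcovers.2 ⟨h5.1, h5.2.2⟩)
    · rw [hall_iff]
      exact fun h5 => (h1 (hpasses.2 h5.1)).trans (hok h5.2)
    · rw [hall_iff]
      intro h5
      by_cases hp : Passes (neighborList nbr) k d idx par cov v
      · rw [h1 hp]
        exact hnok fun h6 => h5 ⟨hpasses.1 hp, h6⟩
      · exact h2 hp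
    · obtain ⟨j, hj⟩ : ∃ j, idx v = j + 1 := ⟨idx v - 1, by omega⟩
      rw [hj] at hv ht ⊢
      rw [sum_range_succ, ← hv] at ht
      rw [Nat.add_sub_cancel]
      omega
  · intro v
    rw [coverCountAfter, eq_comm, card_eq_zero, filter_eq_empty_iff]
    rintro b - ⟨-, hb⟩
    have := hidx b b.2
    omega
  · intro v hv
    have := hidx v v.2
    omega

/-! ### The program -/

/-- Decides whether a block graph has an exact `(k, d)`-coloring: after a search, the counting
criterion is evaluated with the provisional answer in register `14`. -/
def exactColoringProg (k d : ℕ) : Prog :=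
  .seq (.const 1 1) <| .seq (.const 11 (d + 1)) <| .seq (.const 12 d) <| .seq (.const 13 k) <|
  .seq (.const 14 1) <| .seq search <| .seq evaluate <| .copy 0 14

theorem sum_length_eq (hnbr : G.IsAdjacencyList nbr) :
    ∑ v ∈ range n, (neighborList nbr v).length = 2 * G.edgeSet.ncard := by
  classical
  rw [sum_range, Set.ncard_eq_toFinset_card', Set.toFinset_card, ← edgeFinset_card,
    ← sum_degrees_eq_twice_card_edges]
  refine sum_congr rfl fun v _ => ?_
  rw [neighborList, dif_pos v.2, List.length_map, ← List.toFinset_card_of_nodup (hnbr v).1,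
    ← card_neighborFinset_eq_degree]
  congr 1
  ext w
  rw [List.mem_toFinset, (hnbr v).2, mem_neighborFinset]

theorem SearchInv.sum_ord (h : SearchInv n (neighborList nbr) ord idx par n n)
    (hall : ∀ v < n, idx v ≠ 0) : ∑ p ∈ range n, (neighborList nbr (ord (p + 1))).length =
      ∑ v ∈ range n, (neighborList nbr v).length := by
  refine sum_nbij' (fun p => ord (p + 1)) (fun v => idx v - 1) ?_ ?_ ?_ ?_ (fun _ _ => rfl) <;>
    intro p hp <;> rw [mem_range] at hp
  · exact mem_range.2 (h.ord_spec (p + 1) (by omega) hp).1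
  · have := (h.idx_spec p (hall p hp)).2.1
    have := hall p hp
    exact mem_range.2 (by omega)
  · have := (h.ord_spec (p + 1) (by omega) hp).2
    omega
  · have := hall p hp
    rw [Nat.sub_add_cancel (by omega)]
    exact (h.idx_spec p this).2.2

theorem IsListing.offset_eq_sum {N : ℕ → List ℕ} {offset target : ℕ → ℕ}
    (hL : IsListing n N offset target) (h0 : offset 0 = 0) :
    offset n = ∑ v ∈ range n, (N v).length := by
  have : ∀ i ≤ n, offset i = ∑ v ∈ range i, (N v).length := by
    intro i hi
    induction i with
    | zero => simpa using h0
    | succ i ih => rw [hL.offset_succ i hi, ih (by omega), sum_range_succ]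
  exact this n le_rfl

theorem exactColoringProg_spec (hk : 0 < k) (hd : 0 < d) (hG : G.IsBlockGraph)
    (hnbr : G.IsAdjacencyList nbr) : ∃ (t : ℕ) (τ : Store),
      t ≤ (100 + d + k) * (n + G.edgeSet.ncard + 1) ∧
      Computes ((100 + d + k) * (n + G.edgeSet.ncard + 1)) (exactColoringProg k d)
        (inputStore nbr) t τ ∧
      (G.exactChromaticNumber d ≤ (k : ℕ∞) → τ.reg 0 = 1) ∧
      (¬ G.exactChromaticNumber d ≤ (k : ℕ∞) → τ.reg 0 = 0) := by
  set m := G.edgeSet.ncard with hm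
  set W := (100 + d + k) * (n + m + 1) with hWdef
  have hW : 100 * (n + m + 1) + d + k ≤ W := by
    have : d + k ≤ (d + k) * (n + m + 1) := Nat.le_mul_of_pos_right _ (by omega)
    have : W = 100 * (n + m + 1) + (d + k) * (n + m + 1) := by
      rw [hWdef]
      ring
    omega
  have hL := isListing_inputStore nbr
  have hoff := (hL.offset_eq_sum (by simp [inputStore])).trans (sum_length_eq hnbr)
  rw [← hm] at hoff
  suffices hwp : wp W (exactColoringProg k d) (fun τ t => t ≤ W ∧
      (G.exactChromaticNumber d ≤ (k : ℕ∞) → τ.reg 0 = 1) ∧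
      (¬ G.exactChromaticNumber d ≤ (k : ℕ∞) → τ.reg 0 = 0)) (inputStore nbr) 0 by
    obtain ⟨t, τ, ht, h1, h2, h3⟩ := exists_computes_of_wp hwp
    exact ⟨t, τ, by omega, ht, h2, h3⟩
  rw [exactColoringProg]
  simp only [wp_seq, wp_const]
  refine ⟨by omega, by omega, by omega, by omega, by omega, ?_⟩
  refine wp_search (k := k) (d := d) (ok := 1) (cov := fun _ => 0) hL (by omega)
    (mem_neighborList_symm hnbr) ?_ ?_ ?_ ?_ ?_ ?_ ?_ ?_
  · constructor <;> simp [inputStore]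
  · simp [inputStore]
  · simp [inputStore]
  · simp [inputStore]
  · simp [inputStore]
  · simp [inputStore]
  · simp [inputStore]
  intro σ₁ t₁ hC₁ h4 hI hall ht₁
  rw [hI.sum_ord hall, sum_length_eq hnbr, ← hm] at ht₁
  obtain ⟨cov', hcov'⟩ := exists_isCoverCount d (hI.isSearchOrder hnbr hall)
  have hiff := (hI.isSearchOrder hnbr hall).exactChromaticNumber_le_iff_isFeasible hG hk hd hcov'
  refine wp_evaluate (k := k) hnbr hL (by omega) hd hI hall hcov' ⟨hC₁, h4, rfl, rfl, rfl⟩ ?_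
  intro σ₂ t₂ h14 hyes hno ht₂
  rw [hI.sum_ord hall, sum_length_eq hnbr, ← hm] at ht₂
  refine ⟨h14, by omega, ?_, ?_⟩
  · simpa [hiff] using hyes
  · simpa [hiff] using hno

end

end RAM

theorem mainTheorem9 (k d : ℕ) (hk : 0 < k) (hd : 0 < d) :
    RAM.SolvableInLinearTimeOn (fun _ G => G.IsBlockGraph)
      (fun _ G => G.exactChromaticNumber d ≤ (k : ℕ∞)) ∧
    ∀ (V : Type*) [Finite V] (G : SimpleGraph V), G.IsBlockGraph →
      ∀ c : V → Fin k, G.IsExactColoring d c →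
        ∀ (i : Fin k) (K : (G.induce {v : V | c v = i}).ConnectedComponent),
          (G.induce {v : V | c v = i}).IsClique K.supp ∧ K.supp.ncard = d + 1 :=
  ⟨⟨RAM.exactColoringProg k d, 100 + d + k, fun _ _ _ hG hnbr =>
      RAM.exactColoringProg_spec hk hd hG hnbr⟩,
    fun _ _ _ hG _ hc i K => hG.isClique_supp_of_isExactColoring hc i K⟩
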